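/- Let $N>n\ge 1$ be integers, $r>0$, $\Lambda\ge 0$, and $$r_\Lambda=\big((3n+2)(\Lambda+1)^{1/2}\big)^{-1}.$$ Write $B^n_\rho=\{z\in\mathbb C^n : |z|<\rho\}$. Let $f:B^n_r\to\mathbb C^{N-n}$ be a holomorphic map with $f(0)=0$ and $Df(0)=0$, and let $$\omega_f=\tfrac{\sqrt{-1}}{2}\,\partial\bar\partial\log(1+|z|^2+|f|^2)=\tfrac{\sqrt{-1}}{2}\sum_{i,j=1}^n g_{i\bar j}\,dz^i\wedge d\bar z^j .$$ Let $R(\omega_f)=-4\sum_{i,j}g^{i\bar j}\,\frac{\partial^2}{\partial z^i\partial\bar z^j}\log\det(g_{k\bar l})$ be its scalar curvature, where $\sum_j g^{i\bar j}g_{k\bar j}=\delta^i_k$. Suppose that there is a Hermitian $(N+1)\times(N+1)$ matrix $A$ with $A\le\Lambda I_{N+1}$ such that on $B^n_r$ $$n(n+1)-\tfrac14 R(\omega_f)=\frac{(1,z,f)^*A\,(1,z,f)}{1+|z|^2+|f|^2}.$$ Then, with $|Df|^2=\sum_{i=1}^n|\partial f/\partial z^i|^2$, $$1+|z|^2+|f|^2+|Df|^2\le\big(1-r_\Lambda^{-1}|z|\big)^{-\frac{2}{3n+2}}\qquad\text{for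 all } z\in B^n_r \text{ with } |z|<r_\Lambda .$$ Moreover, if $r<r_\Lambda$, then $f$ extends to a holomorphic map on $B^n_{r_\Lambda}$. -/

import Mathlib

open scoped ComplexOrder

noncomputable section

namespace KahlerGraph

/-- The Wirtinger derivative `∂u/∂zⁱ = (∂u/∂xⁱ - √-1 ∂u/∂yⁱ) / 2`, where `zⁱ = xⁱ + √-1 yⁱ`. -/
def dz {n : ℕ} (i : Fin n) (u : EuclideanSpace ℂ (Fin n) → ℂ)
    (z : EuclideanSpace ℂ (Fin n)) : ℂ :=
  (fderiv ℝ u z (EuclideanSpace.single i 1)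
    - Complex.I * fderiv ℝ u z (EuclideanSpace.single i Complex.I)) / 2

/-- The Wirtinger derivative `∂u/∂z̄ⁱ = (∂u/∂xⁱ + √-1 ∂u/∂yⁱ) / 2`. -/
def dzbar {n : ℕ} (i : Fin n) (u : EuclideanSpace ℂ (Fin n) → ℂ)
    (z : EuclideanSpace ℂ (Fin n)) : ℂ :=
  (fderiv ℝ u z (EuclideanSpace.single i 1)
    + Complex.I * fderiv ℝ u z (EuclideanSpace.single i Complex.I)) / 2

/-- The complex Hessian `(∂²u/∂zⁱ∂z̄ʲ)`: the coefficients of `∂∂̄u = ∑ uᵢⱼ dzⁱ ∧ dz̄ʲ`. -/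
def complexHessian {n : ℕ} (u : EuclideanSpace ℂ (Fin n) → ℂ)
    (z : EuclideanSpace ℂ (Fin n)) : Matrix (Fin n) (Fin n) ℂ :=
  Matrix.of fun i j => dz i (dzbar j u) z

/-- The Ricci tensor `Ricᵢⱼ = -∂²(log det g)/∂zⁱ∂z̄ʲ` of the Kähler metric
`ω = (√-1/2) ∑ gᵢⱼ dzⁱ ∧ dz̄ʲ`. (For a metric, `det g` is a positive real number, so that
`Complex.log` is its real logarithm.) -/
def ricci {n : ℕ} (g : EuclideanSpace ℂ (Fin n) → Matrix (Fin n) (Fin n) ℂ)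
    (z : EuclideanSpace ℂ (Fin n)) : Matrix (Fin n) (Fin n) ℂ :=
  -complexHessian (fun x => Complex.log (g x).det) z

/-- The (Riemannian) scalar curvature `R(ω)` of the Kähler metric
`ω = (√-1/2) ∑ gᵢⱼ dzⁱ ∧ dz̄ʲ`: four times the contraction of the Ricci tensor with the inverse
of `(gᵢⱼ)`. The factor `4` comes from the normalization of `ω`: the underlying Riemannian metric
pairs `∂/∂zⁱ` with `∂/∂z̄ʲ` to `gᵢⱼ / 2`, and the full real trace is twice the trace over the
`(1,0)` indices. So the Fubini-Study metric `(√-1/2) ∂∂̄ log (1 + |z|²)` has `R = 4 n (n + 1)`. -/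
def scalarCurvature {n : ℕ} (g : EuclideanSpace ℂ (Fin n) → Matrix (Fin n) (Fin n) ℂ)
    (z : EuclideanSpace ℂ (Fin n)) : ℂ :=
  4 * ((g z)⁻¹ * ricci g z).trace

/-- The coefficients `gᵢⱼ` of `ω_f = (√-1/2) ∂∂̄ log (1 + |z|² + |f|²)`. -/
def graphMetric {n k : ℕ} (f : EuclideanSpace ℂ (Fin n) → EuclideanSpace ℂ (Fin k))
    (z : EuclideanSpace ℂ (Fin n)) : Matrix (Fin n) (Fin n) ℂ :=
  complexHessian (fun x => ((Real.log (1 + ‖x‖ ^ 2 + ‖f x‖ ^ 2) : ℝ) : ℂ)) z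

/-- The vector `(1, z, f(z)) ∈ ℂ^(N + 1)`, where `N = n + k`. -/
def graphVec {n k : ℕ} (f : EuclideanSpace ℂ (Fin n) → EuclideanSpace ℂ (Fin k))
    (z : EuclideanSpace ℂ (Fin n)) : Fin (n + k + 1) → ℂ :=
  Fin.cons 1 (Fin.append (fun i => z i) (fun a => f z a))

/-- `|Df|² = ∑ᵢ |∂f/∂zⁱ|²`, the sum of the squared moduli of all first partial derivatives. -/
def gradNormSq {n k : ℕ} (f : EuclideanSpace ℂ (Fin n) → EuclideanSpace ℂ (Fin k))
    (z : EuclideanSpace ℂ (Fin n)) : ℝ :=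
  ∑ i : Fin n, ‖fderiv ℂ f z (EuclideanSpace.single i 1)‖ ^ 2

/-- The radius `r_Λ = ((3n + 2) (Λ + 1)^(1/2))⁻¹`. -/
def extRadius (n : ℕ) (Λ : ℝ) : ℝ := ((3 * n + 2) * Real.sqrt (Λ + 1))⁻¹

end KahlerGraph

end

/-! Let `G = (plucker f p)ₚ` be the Plücker vector of the `(n + 1) × (N + 1)` matrix with rows
`F = (1, z, f)` and `∂F/∂zⁱ`. By Cauchy–Binet `det g = |G|² / |F|^(2n + 2)`, and the Gauss equation
says that `n(n + 1) - R/4` is the squared norm of the second fundamental form: after multiplication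
by `2 |F|² |G|⁶` this is a sum of squares of holomorphic functions, which are polynomials in the
second derivatives of `f` with coefficients depending on its first jet. The hypothesis therefore
has the form `|P|² + |Q|² = |√(2Λ) G ⊗ G ⊗ G ⊗ F|²` with all entries holomorphic, and by Calabi's
rigidity theorem `P` is the image of `√(2Λ) G ⊗ G ⊗ G ⊗ F` under a linear contraction `L`.

Since `L` is a contraction, the second fundamental form is bounded by `Λ`. This bounds
`∑ |∂ᵢ∂ₗf|²` by a power of `J = 1 + |z|² + |f|² + |Df|²`, so that `J` satisfies a differential
inequality along rays, whose integration is the asserted bound. Since some entries of `P` are the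
second derivatives of `f`, the relation with `L` also is a holomorphic ordinary differential
equation, with a vector field independent of the radius, for the first jet of `f` along rays. As
the jet stays bounded, its solutions continue by a uniform amount beyond each radius
less than `r_Λ`. -/

noncomputable section

namespace KahlerGraph

open Filter Matrix Metric Set Topology

/-! ### Holomorphic maps of several variables -/

section SeveralVariables

theorem ball_half_subset_of_mem {α : Type*} [PseudoMetricSpace α] {x y : α} {R : ℝ}
    (hy : y ∈ ball x (R / 2)) : ball y (R / 2) ⊆ ball x R :=
  ball_subset_ball' (by linarith [mem_ball.1 hy])

variable {E F : Type*} [NormedAddCommGroup E] [NormedSpace ℂ E]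
  [NormedAddCommGroup F] [NormedSpace ℂ F]

theorem norm_fderiv_le_of_forall_norm_le {f : E → F} {c : E} {R C : ℝ} (hR : 0 < R)
    (hf : DifferentiableOn ℂ f (ball c R)) (hC : ∀ x ∈ ball c R, ‖f x‖ ≤ C) :
    ‖fderiv ℂ f c‖ ≤ 2 * C / R := by
  refine Complex.norm_fderiv_le_div_of_mapsTo_ball hf (fun x hx => ?_) hR
  rw [mem_closedBall_iff_norm, two_mul]
  exact norm_sub_le_of_le (hC x hx) (hC c (mem_ball_self hR))

theorem hasDerivAt_comp_add_smul {f : E → F} {z v : E} {t : ℂ}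
    (hf : DifferentiableAt ℂ f (z + t • v)) :
    HasDerivAt (fun s : ℂ => f (z + s • v)) (fderiv ℂ f (z + t • v) v) t := by
  have hline : HasDerivAt (fun s : ℂ => z + s • v) v t := by
    simpa using ((hasDerivAt_id t).smul_const v).const_add z
  exact hf.hasFDerivAt.comp_hasDerivAt t hline

variable [CompleteSpace F]

theorem differentiableOn_of_tendstoUniformlyOn {ι : Type*} {l : Filter ι} [l.NeBot]
    {f : ι → E → F} {g : E → F} {U : Set E} (hU : IsOpen U)
    (hf : ∀ᶠ i in l, DifferentiableOn ℂ (f i) U) (hfg : TendstoUniformlyOn f g l U) :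
    DifferentiableOn ℂ g U := by
  intro x hx
  obtain ⟨R, hR, hRU⟩ := Metric.isOpen_iff.1 hU x hx
  have hxR : ball x (R / 2) ∈ 𝓝 x := ball_mem_nhds x (half_pos hR)
  have hsub : ∀ y ∈ ball x (R / 2), ball y (R / 2) ⊆ U := fun y hy =>
    (ball_half_subset_of_mem hy).trans hRU
  have hcauchy : UniformCauchySeqOn (fun i => fderiv ℂ (f i)) l (ball x (R / 2)) := by
    intro u hu
    obtain ⟨ε, hε, hεu⟩ := Metric.mem_uniformity_dist.1 hu
    have hsmall := hfg.uniformCauchySeqOn _ (Metric.dist_mem_uniformity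
      (show 0 < ε * R / 8 by positivity))
    filter_upwards [hsmall, hf.prod_mk hf] with ⟨i, j⟩ hij ⟨hi, hj⟩ y hy
    have hd : ∀ k, DifferentiableOn ℂ (f k) U → DifferentiableAt ℂ (f k) y := fun k hk =>
      hk.differentiableAt (hU.mem_nhds (hsub y hy (mem_ball_self (half_pos hR))))
    refine hεu ?_
    rw [dist_eq_norm, ← fderiv_sub (hd i hi) (hd j hj)]
    calc ‖fderiv ℂ (f i - f j) y‖ ≤ 2 * (ε * R / 8) / (R / 2) :=
          norm_fderiv_le_of_forall_norm_le (half_pos hR) ((hi.sub hj).mono (hsub y hy))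
            fun w hw => (dist_eq_norm (f i w) (f j w)).symm.trans_le (hij w (hsub y hy hw)).le
      _ = ε / 2 := by field_simp; norm_num
      _ < ε := half_lt_self hε
  have hlim : ∀ y ∈ ball x (R / 2), ∃ g', Tendsto (fun i => fderiv ℂ (f i) y) l (𝓝 g') :=
    fun y hy => cauchy_map_iff_exists_tendsto.1 (hcauchy.cauchy_map hy)
  choose! g' hg' using hlim
  have huniform := hcauchy.tendstoUniformlyOn_of_tendsto hg'
  refine (hasFDerivAt_of_tendstoUniformlyOnFilter (f := f) (g' := g')
    (huniform.tendstoUniformlyOnFilter.mono_right (le_principal_iff.2 hxR)) ?_ ?_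
    ).differentiableAt.differentiableWithinAt
  · filter_upwards [hf.prod_mk hxR] with ⟨i, y⟩ ⟨hi, hy⟩
    exact (hi.differentiableAt (hU.mem_nhds (hsub y hy (mem_ball_self (half_pos hR))))).hasFDerivAt
  · filter_upwards [hU.mem_nhds hx] with y hy using hfg.tendsto_at hy

/-- The Schwarz lemma, applied to `g` and then to its difference quotient. -/
theorem dist_dslope_deriv_le {g : ℂ → F} {ε C : ℝ} (hg : DifferentiableOn ℂ g (ball 0 ε))
    (hC : ∀ s ∈ ball (0 : ℂ) ε, ‖g s‖ ≤ C) {t : ℂ} (ht : t ∈ ball (0 : ℂ) ε) :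
    dist (dslope g 0 t) (deriv g 0) ≤ 4 * C / ε ^ 2 * ‖t‖ := by
  have hε := pos_of_mem_ball ht
  have hmaps : MapsTo g (ball 0 ε) (closedBall (g 0) (C + C)) := fun s hs => by
    simpa only [mem_closedBall_iff_norm] using
      norm_sub_le_of_le (hC s hs) (hC 0 (mem_ball_self hε))
  have hslope : ∀ s ∈ ball (0 : ℂ) ε, ‖dslope g 0 s‖ ≤ (C + C) / ε := fun s hs =>
    Complex.norm_dslope_le_div_of_mapsTo_ball hg hmaps hs
  have hmaps' : MapsTo (dslope g 0) (ball 0 ε)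
      (closedBall (dslope g 0 0) ((C + C) / ε + (C + C) / ε)) := fun s hs => by
    simpa only [mem_closedBall_iff_norm] using
      norm_sub_le_of_le (hslope s hs) (hslope 0 (mem_ball_self hε))
  have h := Complex.dist_le_div_mul_dist_of_mapsTo_ball
    ((Complex.differentiableOn_dslope (ball_mem_nhds 0 hε)).2 hg) hmaps' ht
  rw [dslope_same, dist_zero_right] at h
  convert h using 2
  field_simp
  ring

/-- The difference quotients of `f` in the direction `v` converge to its directional derivative
uniformly, because they satisfy a Lipschitz bound depending only on a bound for `f`. -/
theorem differentiableOn_fderiv_apply {f : E → F} {U : Set E} (hU : IsOpen U)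
    (hf : DifferentiableOn ℂ f U) (v : E) : DifferentiableOn ℂ (fun z => fderiv ℂ f z v) U := by
  intro z₀ hz₀
  have hd : ∀ x ∈ U, DifferentiableAt ℂ f x := fun x hx => hf.differentiableAt (hU.mem_nhds hx)
  obtain ⟨R, hR, hball⟩ : ∃ R > 0, ball z₀ R ⊆ U ∩ {x | ‖f x‖ < ‖f z₀‖ + 1} :=
    Metric.mem_nhds_iff.1 (inter_mem (hU.mem_nhds hz₀)
      ((hd z₀ hz₀).continuousAt.norm.eventually_lt continuousAt_const (lt_add_one _)))
  set C := ‖f z₀‖ + 1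
  set ε := R / 2 / (‖v‖ + 1)
  have hε : 0 < ε := by positivity
  have hmem : ∀ z ∈ ball z₀ (R / 2), ∀ t ∈ ball (0 : ℂ) ε,
      z + t • v ∈ U ∩ {x | ‖f x‖ < C} := fun z hz t ht => by
    refine hball (ball_half_subset_of_mem hz ?_)
    rw [mem_ball_iff_norm, add_sub_cancel_left, norm_smul]
    rw [mem_ball_zero_iff, lt_div_iff₀ (by positivity)] at ht
    nlinarith [norm_nonneg t]
  have hslice : ∀ z ∈ ball z₀ (R / 2),
      DifferentiableOn ℂ (fun s : ℂ => f (z + s • v)) (ball 0 ε) := fun z hz s hs =>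
    (hasDerivAt_comp_add_smul (hd _ (hmem z hz s hs).1)).differentiableAt.differentiableWithinAt
  have hlimit : TendstoUniformlyOn (fun t z => dslope (fun s : ℂ => f (z + s • v)) 0 t)
      (fun z => fderiv ℂ f z v) (𝓝[≠] 0) (ball z₀ (R / 2)) := by
    have htend : Tendsto (fun t : ℂ => 4 * C / ε ^ 2 * ‖t‖) (𝓝[≠] 0) (𝓝 0) :=
      (Continuous.tendsto' (by fun_prop) 0 0 (by simp)).mono_left nhdsWithin_le_nhds
    refine Metric.tendstoUniformlyOn_iff.2 fun η hη => ?_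
    filter_upwards [htend.eventually_lt_const hη, nhdsWithin_le_nhds (ball_mem_nhds 0 hε)]
      with t htη ht z hz
    have hderiv : deriv (fun s : ℂ => f (z + s • v)) 0 = fderiv ℂ f z v := by
      simpa using (hasDerivAt_comp_add_smul (hd _ (hmem z hz 0 (mem_ball_self hε)).1)).deriv
    rw [dist_comm, ← hderiv]
    exact (dist_dslope_deriv_le (hslice z hz) (fun s hs => (hmem z hz s hs).2.le) ht).trans_lt htη
  refine (differentiableOn_of_tendstoUniformlyOn isOpen_ball ?_ hlimit).differentiableAt
    (ball_mem_nhds z₀ (half_pos hR)) |>.differentiableWithinAt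
  filter_upwards [self_mem_nhdsWithin, nhdsWithin_le_nhds (ball_mem_nhds 0 hε)] with t ht0 ht
  simp only [dslope_of_ne _ ht0, slope_def_module, zero_smul, add_zero]
  exact fun z hz => ((((hd _ (hmem z hz t ht).1).comp z (differentiableAt_id.add_const _)).sub
    (hd z (by simpa using (hmem z hz 0 (mem_ball_self hε)).1))).const_smul _).differentiableWithinAt

variable [FiniteDimensional ℂ E]

theorem contDiffOn_of_differentiableOn {f : E → F} {U : Set E} (hU : IsOpen U)
    (hf : DifferentiableOn ℂ f U) (N : ℕ) : ContDiffOn ℂ N f U := by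
  induction N generalizing f with
  | zero => exact contDiffOn_zero.2 hf.continuousOn
  | succ N ih =>
    rw [Nat.cast_succ, contDiffOn_succ_iff_fderiv_apply hU.uniqueDiffOn]
    refine ⟨hf, by simp, fun v => (ih (differentiableOn_fderiv_apply hU hf v)).congr fun x hx => ?_⟩
    rw [fderivWithin_of_isOpen hU hx]

end SeveralVariables

/-! ### Calabi rigidity -/

section Rigidity

theorem exists_linear_contraction_of_inner_eq {𝕜 α H K : Type*} [RCLike 𝕜]
    [NormedAddCommGroup H] [InnerProductSpace 𝕜 H] [NormedAddCommGroup K] [InnerProductSpace 𝕜 K]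
    [FiniteDimensional 𝕜 K] {a : α → H} {b : α → K}
    (hab : ∀ x y, inner 𝕜 (a x) (a y) = inner 𝕜 (b x) (b y)) :
    ∃ L : K →ₗ[𝕜] H, (∀ x, L (b x) = a x) ∧ ∀ v, ‖L v‖ ≤ ‖v‖ := by
  let Ta := Finsupp.linearCombination 𝕜 a
  let Tb := Finsupp.linearCombination 𝕜 b
  have hnorm : ∀ c, ‖Ta c‖ = ‖Tb c‖ := fun c => by
    have hinner : inner 𝕜 (Ta c) (Ta c) = inner 𝕜 (Tb c) (Tb c) := by
      simp only [Ta, Tb, Finsupp.linearCombination_apply, Finsupp.sum, sum_inner, inner_sum,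
        inner_smul_left, inner_smul_right, hab]
    rw [@norm_eq_sqrt_re_inner 𝕜, @norm_eq_sqrt_re_inner 𝕜, hinner]
  have hker : ∀ c c', Tb c = Tb c' → Ta c = Ta c' := fun c c' h => by
    rw [← sub_eq_zero, ← map_sub, ← norm_eq_zero, hnorm, map_sub, h, sub_self, norm_zero]
  obtain ⟨s, hs⟩ := Tb.rangeRestrict.exists_rightInverse_of_surjective Tb.range_rangeRestrict
  have hs' : ∀ y : Tb.range, Tb (s y) = y := fun y =>
    congrArg Subtype.val (LinearMap.congr_fun hs y)
  let P := Tb.range.orthogonalProjectionOnto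
  refine ⟨Ta ∘ₗ s ∘ₗ P.toLinearMap, fun x => ?_, fun v => ?_⟩
  · have hb : Tb (Finsupp.single x 1) = b x := by simp [Tb]
    have hP : (P (b x) : K) = b x := congrArg Subtype.val
      (Submodule.orthogonalProjectionOnto_mem_subspace_eq_self (⟨b x, _, hb⟩ : Tb.range))
    calc Ta (s (P (b x))) = Ta (Finsupp.single x 1) := hker _ _ (by rw [hs', hP, hb])
      _ = a x := by simp [Ta]
  · calc ‖Ta (s (P v))‖ = ‖P v‖ := by rw [hnorm, hs', Submodule.coe_norm]
      _ ≤ ‖v‖ := Tb.range.norm_orthogonalProjectionOnto_apply_le v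

variable {E H K : Type*} [NormedAddCommGroup E] [NormedSpace ℂ E]
  [NormedAddCommGroup H] [InnerProductSpace ℂ H] [NormedAddCommGroup K] [InnerProductSpace ℂ K]

theorem differentiableAt_inner_conj {u v : ℂ → H} {s : ℂ}
    (hu : DifferentiableAt ℂ u (starRingEnd ℂ s)) (hv : DifferentiableAt ℂ v s) :
    DifferentiableAt ℂ (fun s => inner ℂ (u (starRingEnd ℂ s)) (v s)) s := by
  have hu' : HasFDerivAt (fun s => u (starRingEnd ℂ s)) _ s :=
    (hu.hasFDerivAt.restrictScalars ℝ).comp s Complex.conjCLE.hasFDerivAt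
  refine (hasFDerivAt_of_restrictScalars (f' := ContinuousLinearMap.toSpanSingleton ℂ
    (inner ℂ (u (starRingEnd ℂ s)) (deriv v s) + inner ℂ (deriv u (starRingEnd ℂ s)) (v s))) ℝ
    (hu'.inner ℂ (hv.hasFDerivAt.restrictScalars ℝ)) ?_).differentiableAt
  refine ContinuousLinearMap.ext fun t => ?_
  simp [fderiv_eq_smul_deriv, fderivInnerCLM_apply, inner_smul_left, inner_smul_right, mul_add]

theorem differentiableAt_inner_conj_line {a : E → H} {m d : E} {s : ℂ}
    (hs : DifferentiableAt ℂ a (m + s • d)) (hs' : DifferentiableAt ℂ a (m + starRingEnd ℂ s • d)) :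
    DifferentiableAt ℂ (fun s => inner ℂ (a (m + starRingEnd ℂ s • d)) (a (m + s • d))) s :=
  differentiableAt_inner_conj (hasDerivAt_comp_add_smul hs').differentiableAt
    (hasDerivAt_comp_add_smul hs).differentiableAt

/-- Polarization: `s ↦ ⟪a (m + s̄ d), a (m + s d)⟫` is holomorphic, hence determined by its values
`‖a (m + s d)‖ ^ 2` at real `s`. At `s = i`, a suitable `m` and `d` give the pair `(w, z)`. -/
theorem inner_eq_inner_of_norm_eq {a : E → H} {b : E → K} {U : Set E} (hU : IsOpen U)
    (hUc : Convex ℝ U) (ha : DifferentiableOn ℂ a U) (hb : DifferentiableOn ℂ b U)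
    (hab : ∀ z ∈ U, ‖a z‖ = ‖b z‖) {z w : E} (hz : z ∈ U) (hw : w ∈ U) :
    inner ℂ (a w) (a z) = inner ℂ (b w) (b z) := by
  set m : E := (2⁻¹ : ℂ) • (z + w) with hm
  set d : E := (2⁻¹ * -Complex.I : ℂ) • (z - w) with hd
  let line : ℂ →ₗ[ℝ] E := (LinearMap.toSpanSingleton ℂ E d).restrictScalars ℝ
  let S : Set ℂ := {s | m + s • d ∈ U} ∩ {s | m + starRingEnd ℂ s • d ∈ U}
  have hS : IsOpen S := (hU.preimage (by fun_prop)).inter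
    (hU.preimage (continuous_const.add (Complex.continuous_conj.smul continuous_const)))
  have hSc : IsPreconnected S := Convex.isPreconnected <|
    ((hUc.translate_preimage_right m).linear_preimage line).inter
      ((hUc.translate_preimage_right m).linear_preimage (line ∘ₗ Complex.conjAe.toLinearMap))
  have hI : m + Complex.I • d = z ∧ m + starRingEnd ℂ Complex.I • d = w := by
    constructor <;> rw [hm, hd] <;> match_scalars <;> norm_num [Complex.ext_iff]
  have hm' : m ∈ U := by
    convert hUc hz hw (by positivity : (0 : ℝ) ≤ 2⁻¹) (by positivity : (0 : ℝ) ≤ 2⁻¹) (by norm_num)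
      using 1
    rw [hm, smul_add, ← Complex.coe_smul, ← Complex.coe_smul]
    norm_num
  have hda : ∀ {x}, x ∈ U → DifferentiableAt ℂ a x := fun hx => ha.differentiableAt (hU.mem_nhds hx)
  have hdb : ∀ {x}, x ∈ U → DifferentiableAt ℂ b x := fun hx => hb.differentiableAt (hU.mem_nhds hx)
  have hreal : Tendsto (fun x : ℝ => (x : ℂ)) (𝓝[≠] 0) (𝓝[≠] 0) :=
    (Complex.continuous_ofReal.tendsto' 0 0 (by simp)).inf (by simp)
  have h0 : (0 : ℂ) ∈ S := by simp [S, hm']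
  have heq := AnalyticOnNhd.eqOn_of_preconnected_of_frequently_eq
    (DifferentiableOn.analyticOnNhd (fun s hs =>
      (differentiableAt_inner_conj_line (hda hs.1) (hda hs.2)).differentiableWithinAt) hS)
    (DifferentiableOn.analyticOnNhd (fun s hs =>
      (differentiableAt_inner_conj_line (hdb hs.1) (hdb hs.2)).differentiableWithinAt) hS) hSc h0
    (hreal.frequently (Eventually.frequently ?_))
    (show Complex.I ∈ S from ⟨hI.1.substr (p := (· ∈ U)) hz, hI.2.substr (p := (· ∈ U)) hw⟩)
  · simpa only [hI.1, hI.2] using heq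
  · filter_upwards [hreal.eventually (nhdsWithin_le_nhds (hS.mem_nhds h0))] with x hx
    simp only [Complex.conj_ofReal, inner_self_eq_norm_sq_to_K, hab _ hx.1]

theorem exists_linear_contraction [FiniteDimensional ℂ K] {a : E → H} {b : E → K} {U : Set E}
    (hU : IsOpen U) (hUc : Convex ℝ U) (ha : DifferentiableOn ℂ a U)
    (hb : DifferentiableOn ℂ b U) (hab : ∀ z ∈ U, ‖a z‖ = ‖b z‖) :
    ∃ L : K →ₗ[ℂ] H, (∀ z ∈ U, L (b z) = a z) ∧ ∀ v, ‖L v‖ ≤ ‖v‖ := by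
  obtain ⟨L, hL, hL'⟩ := exists_linear_contraction_of_inner_eq (𝕜 := ℂ)
    (a := fun z : U => a z) (b := fun z : U => b z)
    fun w z => inner_eq_inner_of_norm_eq hU hUc ha hb hab z.2 w.2
  exact ⟨L, fun z hz => hL ⟨z, hz⟩, hL'⟩

end Rigidity

/-! ### Minors -/

section Exchange

variable {m κ ι : Type*} [DecidableEq m]

/-- The column selection which differs from `g` only at `l`, where it selects the new column `a`. -/
def exchange (g : m → κ) (l : m) (a : ι) : m → κ ⊕ ι :=
  Function.update (Sum.inl ∘ g) l (Sum.inr a)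

variable {g : m → κ} {l l' : m} {a a' : ι}

theorem exchange_injective (hg : g.Injective) : (exchange g l a).Injective := by
  intro x y h
  by_cases hx : x = l <;> by_cases hy : y = l <;> simp_all [exchange, hg.eq_iff]

theorem inl_mem_range_exchange (hg : g.Injective) {x : m} :
    Sum.inl (g x) ∈ range (exchange g l a) ↔ x ≠ l := by
  constructor
  · rintro ⟨y, hy⟩ rfl
    by_cases h : y = x <;> simp_all [exchange, hg.eq_iff]
  · exact fun h => ⟨x, by simp [exchange, h]⟩

theorem inr_mem_range_exchange {b : ι} : Sum.inr b ∈ range (exchange g l a) ↔ b = a := by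
  constructor
  · rintro ⟨y, hy⟩
    by_cases h : y = l <;> simp_all [exchange]
  · rintro rfl
    exact ⟨l, by simp [exchange]⟩

theorem eq_and_eq_of_range_exchange_eq (hg : g.Injective)
    (h : range (exchange g l a) = range (exchange g l' a')) : l = l' ∧ a = a' := by
  constructor
  · by_contra hne
    exact inl_mem_range_exchange hg |>.1 (h ▸ (inl_mem_range_exchange hg).2 hne) rfl
  · exact inr_mem_range_exchange.1 (h ▸ inr_mem_range_exchange.2 rfl)

end Exchange

section Determinants

variable {m κ : Type*} [Fintype m]

theorem det_mul_eq_sum_functions [DecidableEq m] [Fintype κ] {R : Type*} [CommRing R]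
    (A : Matrix m κ R) (B : Matrix κ m R) :
    (A * B).det = ∑ p : m → κ, (A.submatrix id p).det * ∏ i, B (p i) i := by
  classical
  simp only [det_apply, mul_apply, Finset.prod_univ_sum, Fintype.piFinset_univ,
    Finset.prod_mul_distrib, Finset.smul_sum, submatrix_apply, id_eq, Finset.sum_mul]
  rw [Finset.sum_comm]
  simp only [smul_mul_assoc]

/-- The Cauchy-Binet formula, summed over all functions instead of all subsets. -/
theorem card_factorial_mul_det_mul [DecidableEq m] [Fintype κ] {R : Type*} [CommRing R]
    (A : Matrix m κ R) (B : Matrix κ m R) :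
    ((Fintype.card m).factorial : R) * (A * B).det =
      ∑ p : m → κ, (A.submatrix id p).det * (B.submatrix p id).det := by
  have hperm : ∀ τ : Equiv.Perm m, (A * B).det =
      ∑ p : m → κ, (A.submatrix id p).det * (Equiv.Perm.sign τ • ∏ i, B (p (τ i)) i) := by
    intro τ
    rw [det_mul_eq_sum_functions, ← (τ.arrowCongr (Equiv.refl κ)).symm.sum_comp]
    refine Finset.sum_congr rfl fun p _ => ?_
    have hτ : A.submatrix id ((τ.arrowCongr (Equiv.refl κ)).symm p) =
        (A.submatrix id p).submatrix id τ := rfl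
    rw [hτ, det_permute', Units.smul_def, zsmul_eq_mul, mul_comm (Int.cast _) (det _), mul_assoc]
    rfl
  calc ((Fintype.card m).factorial : R) * (A * B).det
      = ∑ _τ : Equiv.Perm m, (A * B).det := by simp [Fintype.card_perm]
    _ = ∑ τ : Equiv.Perm m, ∑ p : m → κ,
          (A.submatrix id p).det * (Equiv.Perm.sign τ • ∏ i, B (p (τ i)) i) :=
        Finset.sum_congr rfl fun τ _ => hperm τ
    _ = ∑ p : m → κ, (A.submatrix id p).det * (B.submatrix p id).det := by
        rw [Finset.sum_comm]
        simp only [← Finset.mul_sum, det_apply (B.submatrix _ id), submatrix_apply, id_eq]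

theorem card_factorial_mul_det_mul_conjTranspose [DecidableEq m] [Fintype κ] (A : Matrix m κ ℂ) :
    ((Fintype.card m).factorial : ℂ) * (A * Aᴴ).det =
      ((∑ p : m → κ, ‖(A.submatrix id p).det‖ ^ 2 : ℝ) : ℂ) := by
  rw [card_factorial_mul_det_mul]
  push_cast
  refine Finset.sum_congr rfl fun p _ => ?_
  rw [← conjTranspose_submatrix, det_conjTranspose, ← Complex.mul_conj']
  rfl

theorem comp_perm_injective {J m κ : Type*} {P : J → m → κ} (hinj : ∀ j, (P j).Injective)
    (hrange : Function.Injective fun j => range (P j)) :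
    Function.Injective fun x : J × Equiv.Perm m => P x.1 ∘ x.2 := by
  rintro ⟨j, σ⟩ ⟨j', σ'⟩ (h : P j ∘ σ = P j' ∘ σ')
  obtain rfl : j = j' := hrange <| by
    simp only [← σ.surjective.range_comp (P j), h, σ'.surjective.range_comp]
  exact congrArg (Prod.mk j) (Equiv.ext fun x => hinj j (congrFun h x))

theorem card_factorial_mul_sum_le_sum_functions [Fintype κ] [DecidableEq m] {J : Type*} [Fintype J]
    {P : J → m → κ} (hinj : ∀ j, (P j).Injective)
    (hrange : Function.Injective fun j => range (P j)) {h : (m → κ) → ℝ}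
    (h0 : ∀ p, 0 ≤ h p) (hσ : ∀ p (σ : Equiv.Perm m), h (p ∘ σ) = h p) :
    ((Fintype.card m).factorial : ℝ) * ∑ j, h (P j) ≤ ∑ p, h p := by
  calc ((Fintype.card m).factorial : ℝ) * ∑ j, h (P j)
      = ∑ x : J × Equiv.Perm m, h (P x.1 ∘ x.2) := by
        simp only [hσ, Fintype.sum_prod_type, Finset.sum_const, Finset.card_univ,
          Fintype.card_perm, nsmul_eq_mul, Finset.mul_sum]
    _ = ∑ p ∈ Finset.univ.map ⟨_, comp_perm_injective hinj hrange⟩, h p :=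
        (Finset.sum_map _ ⟨_, comp_perm_injective hinj hrange⟩ h).symm
    _ ≤ ∑ p, h p := Finset.sum_le_sum_of_subset_of_nonneg (Finset.subset_univ _) fun p _ _ => h0 p

theorem sq_card_factorial_mul_sum_sum_le_sum_sum_functions [Fintype κ] [DecidableEq m] {J : Type*}
    [Fintype J] {P : J → m → κ} (hinj : ∀ j, (P j).Injective)
    (hrange : Function.Injective fun j => range (P j)) {h : (m → κ) → (m → κ) → ℝ}
    (h0 : ∀ p q, 0 ≤ h p q) (hσ : ∀ p q (σ : Equiv.Perm m), h p (q ∘ σ) = h p q)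
    (hcomm : ∀ p q, h q p = h p q) :
    ((Fintype.card m).factorial : ℝ) ^ 2 * ∑ i, ∑ j, h (P i) (P j) ≤ ∑ p, ∑ q, h p q := by
  calc ((Fintype.card m).factorial : ℝ) ^ 2 * ∑ i, ∑ j, h (P i) (P j)
      = ((Fintype.card m).factorial : ℝ) *
          ∑ i, ((Fintype.card m).factorial : ℝ) * ∑ j, h (P i) (P j) := by
        rw [← Finset.mul_sum]
        ring
    _ ≤ ((Fintype.card m).factorial : ℝ) * ∑ i, ∑ q, h (P i) q := by
        gcongr with i
        exact card_factorial_mul_sum_le_sum_functions hinj hrange (h0 (P i)) (hσ (P i))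
    _ ≤ ∑ p, ∑ q, h p q :=
        card_factorial_mul_sum_le_sum_functions hinj hrange
          (h := fun p => ∑ q, h p q) (fun p => Finset.sum_nonneg fun q _ => h0 p q) fun p σ =>
            Finset.sum_congr rfl fun q _ => by rw [hcomm q, hσ, hcomm p]

theorem two_mul_sum_none_some_le_sum_sum {J : Type*} [Fintype J] {h : Option J → Option J → ℝ}
    (h0 : ∀ x y, 0 ≤ h x y) (hcomm : ∀ x y, h y x = h x y) :
    2 * ∑ j, h none (some j) ≤ ∑ x, ∑ y, h x y := by
  have hnone := h0 none none
  have hsome : 0 ≤ ∑ i, ∑ j, h (some i) (some j) :=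
    Finset.sum_nonneg fun i _ => Finset.sum_nonneg fun j _ => h0 _ _
  simp only [Fintype.sum_option, Finset.sum_add_distrib, hcomm none]
  linarith

variable [DecidableEq m]

theorem det_fromCols_submatrix_exchange {ι R : Type*} [CommRing R] {B : Matrix m κ R}
    {g : m → κ} (hB : B.submatrix id g = 1) (Q : Matrix m ι R) (l : m) (a : ι) :
    ((fromCols B Q).submatrix id (exchange g l a)).det = Q l a := by
  have hcol : (fromCols B Q).submatrix id (exchange g l a) =
      (1 : Matrix m m R).updateCol l (fun i => Q i a) := by
    ext i j
    rcases eq_or_ne j l with rfl | hj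
    · simp [exchange]
    · simp [exchange, hj, ← hB]
  rw [hcol, ← cramer_apply, cramer_one]
  rfl

theorem norm_intCast_sign (σ : Equiv.Perm m) : ‖((Equiv.Perm.sign σ : ℤ) : ℂ)‖ = 1 := by
  rcases Int.units_eq_one_or (Equiv.Perm.sign σ) with h | h <;> simp [h]

theorem det_re_le_trace_re_div_card_pow [Nonempty m] {M : Matrix m m ℂ} (hM : M.PosSemidef) :
    M.det.re ≤ (M.trace.re / Fintype.card m) ^ Fintype.card m := by
  have hdet : M.det.re = ∏ i, hM.1.eigenvalues i := by
    rw [hM.1.det_eq_prod_eigenvalues]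
    exact_mod_cast Complex.ofReal_re _
  have htrace : M.trace.re = ∑ i, hM.1.eigenvalues i := by
    rw [hM.1.trace_eq_sum_eigenvalues]
    exact_mod_cast Complex.ofReal_re _
  have hmean : (∏ i, hM.1.eigenvalues i) ^ (Fintype.card m : ℝ)⁻¹ ≤
      (∑ i, hM.1.eigenvalues i) / Fintype.card m := by
    simpa using Real.geom_mean_le_arith_mean Finset.univ (fun _ => 1) hM.1.eigenvalues
      (by simp) (by simp [Fintype.card_pos (α := m)]) fun i _ => hM.eigenvalues_nonneg i
  have hprod : 0 ≤ ∏ i, hM.1.eigenvalues i := Finset.prod_nonneg fun i _ => hM.eigenvalues_nonneg i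
  rw [hdet, htrace, ← Real.rpow_inv_natCast_pow hprod (Fintype.card_ne_zero (α := m))]
  exact pow_le_pow_left₀ (Real.rpow_nonneg hprod _) hmean _

theorem det_add_vecMulVec {R : Type*} [CommRing R] {X : Matrix m m R} (hX : IsUnit X.det)
    (u v : m → R) : (X + vecMulVec u v).det = X.det * (1 + v ⬝ᵥ (X⁻¹ *ᵥ u)) := by
  rw [vecMulVec_eq Unit, det_add_replicateCol_mul_replicateRow hX, det_unique (n := Unit)]
  simp [Matrix.mul_assoc, mul_apply, dotProduct, mulVec]

theorem det_add_fromBlocks_zero {R : Type*} [Field R] {M : Matrix (Unit ⊕ m) (Unit ⊕ m) R}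
    (hM : M (Sum.inl ()) (Sum.inl ()) ≠ 0) (X : Matrix m m R) :
    (M + fromBlocks 0 0 0 X).det = M (Sum.inl ()) (Sum.inl ()) *
      (of (fun i j => M (Sum.inr i) (Sum.inr j) - M (Sum.inl ()) (Sum.inr j) *
        M (Sum.inr i) (Sum.inl ()) / M (Sum.inl ()) (Sum.inl ())) + X).det := by
  set c := M (Sum.inl ()) (Sum.inl ())
  have h11 : M.toBlocks₁₁ = c • 1 := by
    ext
    simp [toBlocks₁₁, c]
  let inv : Invertible M.toBlocks₁₁ := ⟨c⁻¹ • 1, by simp [h11, hM], by simp [h11, hM]⟩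
  have hblocks : M + fromBlocks 0 0 0 X =
      fromBlocks M.toBlocks₁₁ M.toBlocks₁₂ M.toBlocks₂₁ (M.toBlocks₂₂ + X) := by
    conv_lhs => rw [← fromBlocks_toBlocks M]
    rw [fromBlocks_add]
    simp only [add_zero]
  rw [hblocks, det_fromBlocks₁₁, show ⅟M.toBlocks₁₁ = c⁻¹ • 1 from rfl, h11, det_smul_of_tower,
    det_one, Fintype.card_unit, pow_one, smul_eq_mul, mul_one]
  congr 2
  ext i j
  simp only [Matrix.sub_apply, Matrix.add_apply, Matrix.mul_smul, Matrix.mul_one, Matrix.smul_mul,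
    Matrix.smul_apply, smul_eq_mul, toBlocks₂₂, toBlocks₂₁, toBlocks₁₂, of_apply, mul_apply,
    Fintype.univ_punit, Finset.sum_singleton]
  ring

end Determinants

/-! ### Wirtinger derivatives -/

section Wirtinger

variable {n : ℕ} {F : Type*} [NormedAddCommGroup F] [NormedSpace ℂ F]

/-- The holomorphic partial derivative `∂h/∂zⁱ`. -/
def pderiv (i : Fin n) (h : EuclideanSpace ℂ (Fin n) → F) (z : EuclideanSpace ℂ (Fin n)) : F :=
  fderiv ℂ h z (EuclideanSpace.single i 1)

theorem single_I (i : Fin n) :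
    EuclideanSpace.single i Complex.I = Complex.I • EuclideanSpace.single i (1 : ℂ) := by
  ext j
  by_cases h : j = i <;> simp [h]

theorem differentiableOn_pderiv [CompleteSpace F] {h : EuclideanSpace ℂ (Fin n) → F}
    {U : Set (EuclideanSpace ℂ (Fin n))} (hU : IsOpen U) (hh : DifferentiableOn ℂ h U)
    (i : Fin n) : DifferentiableOn ℂ (pderiv i h) U :=
  differentiableOn_fderiv_apply hU hh _

variable {u v h : EuclideanSpace ℂ (Fin n) → ℂ} {z : EuclideanSpace ℂ (Fin n)}

theorem pderiv_const (i : Fin n) (c : ℂ) : pderiv i (fun _ => c) z = 0 := by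
  simp only [pderiv, fderiv_fun_const, Pi.zero_apply, _root_.zero_apply]

theorem dz_congr (h : u =ᶠ[𝓝 z] v) (i : Fin n) : dz i u z = dz i v z := by
  simp only [dz, h.fderiv_eq]

theorem dzbar_congr (h : u =ᶠ[𝓝 z] v) (i : Fin n) : dzbar i u z = dzbar i v z := by
  simp only [dzbar, h.fderiv_eq]

theorem dz_mul (hu : DifferentiableAt ℝ u z) (hv : DifferentiableAt ℝ v z) (i : Fin n) :
    dz i (fun x => u x * v x) z = dz i u z * v z + u z * dz i v z := by
  simp only [dz, fderiv_fun_mul hu hv, _root_.add_apply,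
    _root_.smul_apply, smul_eq_mul]
  ring

theorem dzbar_mul (hu : DifferentiableAt ℝ u z) (hv : DifferentiableAt ℝ v z) (i : Fin n) :
    dzbar i (fun x => u x * v x) z = dzbar i u z * v z + u z * dzbar i v z := by
  simp only [dzbar, fderiv_fun_mul hu hv, _root_.add_apply,
    _root_.smul_apply, smul_eq_mul]
  ring

theorem dz_sum {ι : Type*} [Fintype ι] {u : ι → EuclideanSpace ℂ (Fin n) → ℂ}
    (hu : ∀ p, DifferentiableAt ℝ (u p) z) (i : Fin n) :
    dz i (fun x => ∑ p, u p x) z = ∑ p, dz i (u p) z := by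
  simp only [dz, fderiv_fun_sum fun p _ => hu p, _root_.sum_apply, Finset.mul_sum,
    ← Finset.sum_sub_distrib, Finset.sum_div]

theorem dzbar_sum {ι : Type*} [Fintype ι] {u : ι → EuclideanSpace ℂ (Fin n) → ℂ}
    (hu : ∀ p, DifferentiableAt ℝ (u p) z) (i : Fin n) :
    dzbar i (fun x => ∑ p, u p x) z = ∑ p, dzbar i (u p) z := by
  simp only [dzbar, fderiv_fun_sum fun p _ => hu p, _root_.sum_apply, Finset.mul_sum,
    ← Finset.sum_add_distrib, Finset.sum_div]

theorem dz_sub_const_mul (hu : DifferentiableAt ℝ u z) (hv : DifferentiableAt ℝ v z) (c : ℂ)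
    (i : Fin n) : dz i (fun x => u x - c * v x) z = dz i u z - c * dz i v z := by
  simp only [dz, fderiv_fun_sub hu (hv.const_mul c), fderiv_const_mul hv,
    _root_.sub_apply, _root_.smul_apply, smul_eq_mul]
  ring

theorem dzbar_sub_const_mul (hu : DifferentiableAt ℝ u z) (hv : DifferentiableAt ℝ v z) (c : ℂ)
    (i : Fin n) : dzbar i (fun x => u x - c * v x) z = dzbar i u z - c * dzbar i v z := by
  simp only [dzbar, fderiv_fun_sub hu (hv.const_mul c), fderiv_const_mul hv,
    _root_.sub_apply, _root_.smul_apply, smul_eq_mul]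
  ring

theorem dzbar_sub_const (u : EuclideanSpace ℂ (Fin n) → ℂ) (c : ℂ) (i : Fin n) :
    dzbar i (fun x => u x - c) z = dzbar i u z := by
  simp only [dzbar, fderiv_sub_const]

theorem dz_div (hu : DifferentiableAt ℝ u z) (hv : DifferentiableAt ℝ v z) (h0 : v z ≠ 0)
    (i : Fin n) :
    dz i (fun x => u x / v x) z = dz i u z / v z - u z * dz i v z / v z ^ 2 := by
  have hq : DifferentiableAt ℝ (fun x => u x / v x) z := by
    simp only [div_eq_mul_inv]
    exact hu.mul (hv.inv h0)
  have hev : u =ᶠ[𝓝 z] fun x => u x / v x * v x := by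
    filter_upwards [hv.continuousAt.eventually_ne h0] with x hx
    rw [div_mul_cancel₀ _ hx]
  rw [(dz_congr hev i).trans (dz_mul hq hv i)]
  field_simp
  ring

theorem fderiv_real_apply (hh : DifferentiableAt ℂ h z)
    (w : EuclideanSpace ℂ (Fin n)) : fderiv ℝ h z w = fderiv ℂ h z w := by
  rw [(hh.hasFDerivAt.restrictScalars ℝ).fderiv]
  rfl

theorem dz_of_differentiableAt (hh : DifferentiableAt ℂ h z)
    (i : Fin n) : dz i h z = pderiv i h z := by
  simp only [dz, pderiv, fderiv_real_apply hh, single_I, map_smul, smul_eq_mul]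
  linear_combination (-(1 / 2) * (fderiv ℂ h z) (EuclideanSpace.single i 1)) * Complex.I_mul_I

theorem dzbar_of_differentiableAt (hh : DifferentiableAt ℂ h z) (i : Fin n) : dzbar i h z = 0 := by
  simp only [dzbar, fderiv_real_apply hh, single_I, map_smul, smul_eq_mul]
  linear_combination ((1 / 2) * (fderiv ℂ h z) (EuclideanSpace.single i 1)) * Complex.I_mul_I

theorem differentiableAt_conj (hh : DifferentiableAt ℂ h z) :
    DifferentiableAt ℝ (fun x => starRingEnd ℂ (h x)) z :=
  Complex.conjCLE.differentiableAt.comp z (hh.restrictScalars ℝ)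

theorem fderiv_conj_apply (hh : DifferentiableAt ℂ h z)
    (w : EuclideanSpace ℂ (Fin n)) :
    fderiv ℝ (fun x => starRingEnd ℂ (h x)) z w = starRingEnd ℂ (fderiv ℂ h z w) := by
  have hconj : HasFDerivAt (fun x => starRingEnd ℂ (h x)) _ z :=
    Complex.conjCLE.hasFDerivAt.comp z (hh.hasFDerivAt.restrictScalars ℝ)
  rw [hconj.fderiv]
  rfl

theorem dz_conj (hh : DifferentiableAt ℂ h z)
    (i : Fin n) : dz i (fun x => starRingEnd ℂ (h x)) z = 0 := by
  simp only [dz, fderiv_conj_apply hh, single_I, map_smul, smul_eq_mul, map_mul, Complex.conj_I]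
  linear_combination ((1 / 2) * starRingEnd ℂ ((fderiv ℂ h z) (EuclideanSpace.single i 1))) *
    Complex.I_mul_I

theorem dzbar_conj (hh : DifferentiableAt ℂ h z)
    (i : Fin n) : dzbar i (fun x => starRingEnd ℂ (h x)) z = starRingEnd ℂ (pderiv i h z) := by
  simp only [dzbar, pderiv, fderiv_conj_apply hh, single_I, map_smul, smul_eq_mul, map_mul,
    Complex.conj_I]
  linear_combination (-(1 / 2) * starRingEnd ℂ ((fderiv ℂ h z) (EuclideanSpace.single i 1))) *
    Complex.I_mul_I

theorem dzbar_log {ρ : EuclideanSpace ℂ (Fin n) → ℝ} (hρ : DifferentiableAt ℝ ρ z)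
    (h0 : ρ z ≠ 0) (i : Fin n) :
    dzbar i (fun x => (Real.log (ρ x) : ℂ)) z = dzbar i (fun x => (ρ x : ℂ)) z / ρ z := by
  have hlog : HasFDerivAt (fun x => (Real.log (ρ x) : ℂ)) _ z :=
    Complex.ofRealCLM.hasFDerivAt.comp z (hρ.hasFDerivAt.log h0)
  have hofReal : HasFDerivAt (fun x => (ρ x : ℂ)) _ z :=
    Complex.ofRealCLM.hasFDerivAt.comp z hρ.hasFDerivAt
  simp only [dzbar, hlog.fderiv, hofReal.fderiv, ContinuousLinearMap.comp_apply, _root_.smul_apply,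
    Complex.ofRealCLM_apply, smul_eq_mul, Complex.ofReal_mul, Complex.ofReal_inv]
  ring

end Wirtinger

section LogNormSq

variable {n : ℕ} {ι : Type*} [Fintype ι] {G H : ι → EuclideanSpace ℂ (Fin n) → ℂ}
  {z : EuclideanSpace ℂ (Fin n)} {U : Set (EuclideanSpace ℂ (Fin n))}

/-- The squared norm `∑ |Hₚ|²` of a family of functions. -/
def normSq (H : ι → EuclideanSpace ℂ (Fin n) → ℂ) (x : EuclideanSpace ℂ (Fin n)) : ℝ :=
  ∑ p, ‖H p x‖ ^ 2

/-- The function `log ∑ |Hₚ|²`, complex-valued so that Wirtinger derivatives apply to it. -/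
def logNormSq (H : ι → EuclideanSpace ℂ (Fin n) → ℂ) (x : EuclideanSpace ℂ (Fin n)) : ℂ :=
  (Real.log (normSq H x) : ℝ)

/-- The components `Hₚ ∂H_q/∂zⁱ - H_q ∂Hₚ/∂zⁱ` of `H ∧ ∂H/∂zⁱ`. -/
def wedgeDeriv (H : ι → EuclideanSpace ℂ (Fin n) → ℂ) (p q : ι) (x : EuclideanSpace ℂ (Fin n)) :
    Fin n → ℂ :=
  fun i => H p x * pderiv i (H q) x - H q x * pderiv i (H p) x

theorem ofReal_normSq (H : ι → EuclideanSpace ℂ (Fin n) → ℂ) (x : EuclideanSpace ℂ (Fin n)) :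
    (normSq H x : ℂ) = ∑ p, H p x * starRingEnd ℂ (H p x) := by
  rw [normSq]
  push_cast
  exact Finset.sum_congr rfl fun p _ => (Complex.mul_conj' _).symm

theorem differentiableAt_sum_mul_conj (hH : ∀ p, DifferentiableAt ℂ (H p) z)
    (hG : ∀ p, DifferentiableAt ℂ (G p) z) :
    DifferentiableAt ℝ (fun x => ∑ p, H p x * starRingEnd ℂ (G p x)) z :=
  DifferentiableAt.fun_sum fun p _ =>
    ((hH p).restrictScalars ℝ).mul (differentiableAt_conj (hG p))

theorem dz_sum_mul_conj (hH : ∀ p, DifferentiableAt ℂ (H p) z)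
    (hG : ∀ p, DifferentiableAt ℂ (G p) z) (i : Fin n) :
    dz i (fun x => ∑ p, H p x * starRingEnd ℂ (G p x)) z =
      ∑ p, pderiv i (H p) z * starRingEnd ℂ (G p z) := by
  rw [dz_sum fun p => ((hH p).restrictScalars ℝ).fun_mul (differentiableAt_conj (hG p))]
  refine Finset.sum_congr rfl fun p _ => ?_
  rw [dz_mul ((hH p).restrictScalars ℝ) (differentiableAt_conj (hG p)), dz_conj (hG p),
    dz_of_differentiableAt (hH p), mul_zero, add_zero]

theorem dzbar_sum_mul_conj (hH : ∀ p, DifferentiableAt ℂ (H p) z)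
    (hG : ∀ p, DifferentiableAt ℂ (G p) z) (i : Fin n) :
    dzbar i (fun x => ∑ p, H p x * starRingEnd ℂ (G p x)) z =
      ∑ p, H p z * starRingEnd ℂ (pderiv i (G p) z) := by
  rw [dzbar_sum fun p => ((hH p).restrictScalars ℝ).fun_mul (differentiableAt_conj (hG p))]
  refine Finset.sum_congr rfl fun p _ => ?_
  rw [dzbar_mul ((hH p).restrictScalars ℝ) (differentiableAt_conj (hG p)), dzbar_conj (hG p),
    dzbar_of_differentiableAt (hH p), zero_mul, zero_add]

theorem differentiableAt_normSq (hH : ∀ p, DifferentiableAt ℂ (H p) z) :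
    DifferentiableAt ℝ (normSq H) z :=
  DifferentiableAt.fun_sum fun p _ => ((hH p).restrictScalars ℝ).norm_sq ℂ

theorem differentiableAt_logNormSq (hH : ∀ p, DifferentiableAt ℂ (H p) z)
    (h0 : normSq H z ≠ 0) :
    DifferentiableAt ℝ (logNormSq H) z :=
  Complex.ofRealCLM.differentiableAt.comp z
    ((differentiableAt_normSq hH).log h0)

theorem dzbar_logNormSq (hH : ∀ p, DifferentiableAt ℂ (H p) z)
    (h0 : normSq H z ≠ 0) (i : Fin n) :
    dzbar i (logNormSq H) z =
      (∑ p, H p z * starRingEnd ℂ (pderiv i (H p) z)) / ∑ p, H p z * starRingEnd ℂ (H p z) := by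
  refine (dzbar_log (differentiableAt_normSq hH) h0 i).trans ?_
  simp only [ofReal_normSq, dzbar_sum_mul_conj hH hH]

theorem dzbar_logNormSq_eventuallyEq (hU : IsOpen U) (hH : ∀ p, DifferentiableOn ℂ (H p) U)
    (h0 : ∀ x ∈ U, normSq H x ≠ 0) (hz : z ∈ U) (i : Fin n) :
    dzbar i (logNormSq H) =ᶠ[𝓝 z]
      fun x => (∑ p, H p x * starRingEnd ℂ (pderiv i (H p) x)) /
        ∑ p, H p x * starRingEnd ℂ (H p x) := by
  filter_upwards [hU.mem_nhds hz] with x hx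
  exact dzbar_logNormSq (fun p => (hH p).differentiableAt (hU.mem_nhds hx)) (h0 x hx) i

theorem differentiableAt_dzbar_logNormSq (hU : IsOpen U) (hH : ∀ p, DifferentiableOn ℂ (H p) U)
    (h0 : ∀ x ∈ U, normSq H x ≠ 0) (hz : z ∈ U) (i : Fin n) :
    DifferentiableAt ℝ (dzbar i (logNormSq H)) z := by
  rw [(dzbar_logNormSq_eventuallyEq hU hH h0 hz i).differentiableAt_iff]
  have hd := fun p => (hH p).differentiableAt (hU.mem_nhds hz)
  have hpd := fun p => (differentiableOn_pderiv hU (hH p) i).differentiableAt (hU.mem_nhds hz)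
  simp only [div_eq_mul_inv]
  refine (differentiableAt_sum_mul_conj hd hpd).mul ((differentiableAt_sum_mul_conj hd hd).inv ?_)
  rw [← ofReal_normSq]
  exact_mod_cast h0 z hz

theorem complexHessian_logNormSq (hU : IsOpen U) (hH : ∀ p, DifferentiableOn ℂ (H p) U)
    (h0 : ∀ x ∈ U, normSq H x ≠ 0) (hz : z ∈ U) (i j : Fin n) :
    complexHessian (logNormSq H) z i j =
      (∑ p, pderiv i (H p) z * starRingEnd ℂ (pderiv j (H p) z)) /
        (∑ p, H p z * starRingEnd ℂ (H p z)) -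
      (∑ p, H p z * starRingEnd ℂ (pderiv j (H p) z)) *
        (∑ p, pderiv i (H p) z * starRingEnd ℂ (H p z)) /
        (∑ p, H p z * starRingEnd ℂ (H p z)) ^ 2 := by
  have hd := fun p => (hH p).differentiableAt (hU.mem_nhds hz)
  have hpd := fun p => (differentiableOn_pderiv hU (hH p) j).differentiableAt (hU.mem_nhds hz)
  simp only [complexHessian, of_apply]
  rw [dz_congr (dzbar_logNormSq_eventuallyEq hU hH h0 hz j), dz_div
    (differentiableAt_sum_mul_conj hd hpd) (differentiableAt_sum_mul_conj hd hd) ?_,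
    dz_sum_mul_conj hd hpd, dz_sum_mul_conj hd hd]
  rw [← ofReal_normSq]
  exact_mod_cast h0 z hz

/-- Lagrange's identity. -/
theorem sum_sum_wedge_mul_wedge (a b c d : ι → ℂ) :
    ∑ p, ∑ q, (a p * b q - a q * b p) * (c p * d q - c q * d p) =
      2 * ((∑ p, a p * c p) * (∑ p, b p * d p) - (∑ p, a p * d p) * (∑ p, b p * c p)) := by
  have expand : ∀ p q, (a p * b q - a q * b p) * (c p * d q - c q * d p) =
      a p * c p * (b q * d q) + b p * d p * (a q * c q) -
        a p * d p * (b q * c q) - b p * c p * (a q * d q) := fun p q => by ring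
  simp only [expand, Finset.sum_sub_distrib, Finset.sum_add_distrib, ← Finset.sum_mul_sum]
  ring

theorem complexHessian_logNormSq_eq_sum_vecMulVec (hU : IsOpen U)
    (hH : ∀ p, DifferentiableOn ℂ (H p) U) (h0 : ∀ x ∈ U, normSq H x ≠ 0) (hz : z ∈ U) :
    complexHessian (logNormSq H) z = (2 * (normSq H z : ℂ) ^ 2)⁻¹ • ∑ p, ∑ q,
      vecMulVec (wedgeDeriv H p q z) (star (wedgeDeriv H p q z)) := by
  ext i j
  have hN : ∑ p, H p z * starRingEnd ℂ (H p z) ≠ 0 := by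
    rw [← ofReal_normSq]
    exact_mod_cast h0 z hz
  simp only [complexHessian_logNormSq hU hH h0 hz, ofReal_normSq, Matrix.smul_apply,
    Matrix.sum_apply, vecMulVec_apply, wedgeDeriv, Pi.star_apply, smul_eq_mul, RCLike.star_def,
    map_sub, map_mul, sum_sum_wedge_mul_wedge]
  field_simp

end LogNormSq

/-! ### The metric of a graph and its Plücker coordinates -/

section JetSpace

variable {n k : ℕ}

/-- The space of first jets of maps from `ℂⁿ` to `ℂᵏ`, with coordinates `z`, `f` and `∂f/∂zⁱ`. -/
abbrev JetSpace (n k : ℕ) : Type := EuclideanSpace ℂ (Fin n ⊕ (Fin k ⊕ Fin n × Fin k))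

/-- The first jet of `f` at `z`. -/
def jet (f : EuclideanSpace ℂ (Fin n) → EuclideanSpace ℂ (Fin k))
    (z : EuclideanSpace ℂ (Fin n)) : JetSpace n k :=
  WithLp.toLp 2 <| Sum.elim (fun j => z j) <| Sum.elim (fun a => f z a) fun la =>
    pderiv la.1 f z la.2

/-- The coordinates of `(1, z, f)`, indexed by a sum type, as functions of the jet. -/
def jetCoord (α : (Unit ⊕ Fin n) ⊕ Fin k) (w : JetSpace n k) : ℂ :=
  Sum.elim (Sum.elim (fun _ => 1) fun j => w (Sum.inl j)) (fun a => w (Sum.inr (Sum.inl a))) α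

/-- The matrix with rows `f - ∑ zʲ ∂f/∂zʲ` and `∂f/∂zⁱ`, as a function of the jet. -/
def jetMatrix (w : JetSpace n k) : Matrix (Unit ⊕ Fin n) (Fin k) ℂ :=
  of fun i a => Sum.elim
    (fun _ => w (Sum.inr (Sum.inl a)) - ∑ j, w (Sum.inl j) * w (Sum.inr (Sum.inr (j, a))))
    (fun l => w (Sum.inr (Sum.inr (l, a)))) i

/-- The maximal minors of `(1 | jetMatrix w)`, indexed by all functions `p`, so that every minor
occurs `(n + 1)!` times up to sign. -/
def jetMinor (p : Unit ⊕ Fin n → (Unit ⊕ Fin n) ⊕ Fin k) (w : JetSpace n k) : ℂ :=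
  ((fromCols 1 (jetMatrix w)).submatrix id p).det

theorem differentiableOn_det {E m : Type*} [NormedAddCommGroup E] [NormedSpace ℂ E] [Fintype m]
    [DecidableEq m] {M : E → Matrix m m ℂ} {U : Set E}
    (hM : ∀ i j, DifferentiableOn ℂ (fun x => M x i j) U) :
    DifferentiableOn ℂ (fun x => (M x).det) U := by
  simp only [det_apply, Units.smul_def, zsmul_eq_mul]
  refine DifferentiableOn.fun_sum fun σ _ => DifferentiableOn.const_mul (fun x hx => ?_) _
  exact (HasFDerivWithinAt.finsetProd fun i _ =>
    (hM (σ i) i x hx).hasFDerivWithinAt).differentiableWithinAt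

theorem differentiable_jetCoord (α : (Unit ⊕ Fin n) ⊕ Fin k) : Differentiable ℂ (jetCoord α) := by
  have hcoord := differentiable_euclidean.1 (differentiable_id (𝕜 := ℂ) (E := JetSpace n k))
  rcases α with (_ | j) | a
  · exact differentiable_const _
  · exact hcoord (Sum.inl j)
  · exact hcoord (Sum.inr (Sum.inl a))

theorem differentiable_fromCols_jetMatrix (i : Unit ⊕ Fin n) (α : (Unit ⊕ Fin n) ⊕ Fin k) :
    Differentiable ℂ fun w : JetSpace n k =>
      fromCols (1 : Matrix (Unit ⊕ Fin n) (Unit ⊕ Fin n) ℂ) (jetMatrix w) i α := by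
  have hcoord := differentiable_euclidean.1 (differentiable_id (𝕜 := ℂ) (E := JetSpace n k))
  rcases α with α | a
  · exact differentiable_const _
  rcases i with _ | l
  · exact (hcoord (Sum.inr (Sum.inl a))).sub (Differentiable.fun_sum fun j _ =>
      (hcoord (Sum.inl j)).mul (hcoord (Sum.inr (Sum.inr (j, a)))))
  · exact hcoord (Sum.inr (Sum.inr (l, a)))

theorem differentiable_jetMinor (p : Unit ⊕ Fin n → (Unit ⊕ Fin n) ⊕ Fin k) :
    Differentiable ℂ (jetMinor p) :=
  differentiableOn_univ.1 <| differentiableOn_det fun i j =>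
    (differentiable_fromCols_jetMatrix i (p j)).differentiableOn

theorem differentiableOn_jet {f : EuclideanSpace ℂ (Fin n) → EuclideanSpace ℂ (Fin k)}
    {U : Set (EuclideanSpace ℂ (Fin n))} (hU : IsOpen U) (hf : DifferentiableOn ℂ f U) :
    DifferentiableOn ℂ (jet f) U := by
  refine differentiableOn_euclidean.2 ?_
  rintro (j | a | la)
  · exact differentiableOn_euclidean.1 differentiableOn_id j
  · exact differentiableOn_euclidean.1 hf a
  · exact differentiableOn_euclidean.1 (differentiableOn_pderiv hU hf la.1) la.2

end JetSpace

section Graph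

variable {n k : ℕ} (f : EuclideanSpace ℂ (Fin n) → EuclideanSpace ℂ (Fin k))
  (z : EuclideanSpace ℂ (Fin n))

/-- The coordinates of `F = (1, z, f(z))`. -/
def graphCoord (α : (Unit ⊕ Fin n) ⊕ Fin k) (z : EuclideanSpace ℂ (Fin n)) : ℂ :=
  jetCoord α (jet f z)

/-- The matrix with rows `F = (1, z, f)` and `∂F/∂zⁱ`, the projective frame along the graph. -/
def frameMatrix : Matrix (Unit ⊕ Fin n) ((Unit ⊕ Fin n) ⊕ Fin k) ℂ :=
  of fun i α => Sum.elim (fun _ => graphCoord f α z) (fun l => pderiv l (graphCoord f α) z) i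

/-- The unipotent matrix with first row `(1, z)`, which row-reduces `frameMatrix`. -/
def shearMatrix : Matrix (Unit ⊕ Fin n) (Unit ⊕ Fin n) ℂ :=
  fromBlocks 1 (of fun _ j => z j) 0 1

/-- The preimage of `(0, w)` under `shearMatrix z`. -/
def shearVec (w : Fin n → ℂ) : Unit ⊕ Fin n → ℂ :=
  Sum.elim (fun _ => -∑ j, z j * w j) w

/-- The Plücker coordinates of the Gauss map: the maximal minors of the row-reduced form
`(1 | jetMatrix (jet f z))` of `frameMatrix f z`. -/
def plucker (p : Unit ⊕ Fin n → (Unit ⊕ Fin n) ⊕ Fin k) (z : EuclideanSpace ℂ (Fin n)) : ℂ :=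
  jetMinor p (jet f z)

/-- The matrix `(1 | jetMatrix (jet f z))` augmented by the column `shearVec z w`. -/
def augmented (w : Fin n → ℂ) : Matrix (Unit ⊕ Fin n) (((Unit ⊕ Fin n) ⊕ Fin k) ⊕ Unit) ℂ :=
  fromCols (fromCols 1 (jetMatrix (jet f z))) (replicateCol Unit (shearVec z w))

/-- The maximal minors of the augmented matrix which involve the last column. -/
def augMinor (c : Unit ⊕ Fin n → ((Unit ⊕ Fin n) ⊕ Fin k) ⊕ Unit) (w : Fin n → ℂ) : ℂ :=
  if ∃ x, c x = Sum.inr () then ((augmented f z w).submatrix id c).det else 0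

theorem normSq_graphCoord : normSq (graphCoord f) z = 1 + ‖z‖ ^ 2 + ‖f z‖ ^ 2 := by
  simp [normSq, graphCoord, jetCoord, jet, Fintype.sum_sum_type, EuclideanSpace.norm_sq_eq]

theorem one_le_normSq_graphCoord : 1 ≤ normSq (graphCoord f) z := by
  rw [normSq_graphCoord]
  nlinarith [sq_nonneg ‖z‖, sq_nonneg ‖f z‖]

theorem normSq_graphCoord_pos : 0 < normSq (graphCoord f) z :=
  zero_lt_one.trans_le (one_le_normSq_graphCoord f z)

theorem plucker_inl : plucker f Sum.inl z = 1 := by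
  rw [plucker, ← det_one (n := Unit ⊕ Fin n)]
  congr 1

theorem one_le_normSq_plucker : 1 ≤ normSq (plucker f) z := by
  simpa [plucker_inl, normSq] using Finset.single_le_sum (f := fun p => ‖plucker f p z‖ ^ 2)
    (fun p _ => sq_nonneg _) (Finset.mem_univ Sum.inl)

theorem normSq_plucker_pos : 0 < normSq (plucker f) z :=
  zero_lt_one.trans_le (one_le_normSq_plucker f z)

theorem graphMetric_eq_complexHessian :
    graphMetric f z = complexHessian (logNormSq (graphCoord f)) z := by
  simp only [graphMetric, ← normSq_graphCoord]
  rfl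

theorem det_shearMatrix : (shearMatrix z).det = 1 := by
  simp [shearMatrix]

theorem shearMatrix_mulVec_shearVec (w : Fin n → ℂ) :
    shearMatrix z *ᵥ shearVec z w = Sum.elim (fun _ => 0) w := by
  funext i
  rcases i with u | l <;>
    simp [shearMatrix, shearVec, mulVec, dotProduct, Fintype.sum_sum_type, one_apply]

theorem frameMatrix_gram_inl_inl :
    (frameMatrix f z * (frameMatrix f z)ᴴ) (Sum.inl ()) (Sum.inl ()) =
      (normSq (graphCoord f) z : ℂ) := by
  rw [ofReal_normSq]
  simp [frameMatrix, mul_apply]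

theorem sum_norm_sq_det_augmented (w : Fin n → ℂ) :
    ∑ c, ‖((augmented f z w).submatrix id c).det‖ ^ 2 =
      normSq (plucker f) z + ∑ c, ‖augMinor f z c w‖ ^ 2 := by
  have hsplit : ∀ c, ‖((augmented f z w).submatrix id c).det‖ ^ 2 =
      (if ∃ x, c x = Sum.inr () then 0 else ‖((augmented f z w).submatrix id c).det‖ ^ 2) +
        ‖augMinor f z c w‖ ^ 2 := by
    intro c
    rw [augMinor]
    split_ifs <;> simp
  rw [Finset.sum_congr rfl fun c _ => hsplit c, Finset.sum_add_distrib, normSq]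
  congr 1
  symm
  refine Fintype.sum_of_injective (fun p => Sum.inl ∘ p) Sum.inl_injective.comp_left _ _ ?_ ?_
  · intro c hc
    rw [if_pos]
    by_contra! hne
    have hinl : ∀ x, ∃ y, Sum.inl y = c x := by
      intro x
      rcases hcx : c x with y | u
      · exact ⟨y, rfl⟩
      · exact absurd hcx (hne x)
    choose p hp using hinl
    exact hc ⟨p, funext hp⟩
  · intro p
    rw [if_neg (by simp), plucker]
    rfl

theorem augMinor_zero (c : Unit ⊕ Fin n → ((Unit ⊕ Fin n) ⊕ Fin k) ⊕ Unit) :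
    augMinor f z c 0 = 0 := by
  rw [augMinor]
  split_ifs with h
  · obtain ⟨x, hx⟩ := h
    refine det_eq_zero_of_column_eq_zero x fun i => ?_
    rcases i with i | i <;> simp [augmented, hx, shearVec]
  · rfl

variable {f z} {U : Set (EuclideanSpace ℂ (Fin n))}

theorem pderiv_coord (hf : DifferentiableAt ℂ f z) (i : Fin n) (a : Fin k) :
    pderiv i (fun x => f x a) z = pderiv i f z a := by
  have hcoord : HasFDerivAt (fun x => f x a) _ z :=
    (EuclideanSpace.proj (𝕜 := ℂ) a).hasFDerivAt.comp z hf.hasFDerivAt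
  rw [pderiv, hcoord.fderiv]
  rfl

theorem differentiableOn_graphCoord (hf : DifferentiableOn ℂ f U) (α) :
    DifferentiableOn ℂ (graphCoord f α) U := by
  rcases α with (_ | j) | a
  · exact differentiableOn_const _
  · exact differentiableOn_euclidean.1 differentiableOn_id j
  · exact differentiableOn_euclidean.1 hf a

theorem pderiv_graphCoord (hf : DifferentiableAt ℂ f z) (l : Fin n) (α) :
    pderiv l (graphCoord f α) z =
      Sum.elim (Sum.elim (fun _ => 0) fun j => if l = j then 1 else 0)
        (fun a => pderiv l f z a) α := by
  rcases α with (_ | j) | a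
  · exact pderiv_const l 1
  · have hproj : fderiv ℂ (graphCoord f (Sum.inl (Sum.inr j))) z = EuclideanSpace.proj (𝕜 := ℂ) j :=
      (EuclideanSpace.proj (𝕜 := ℂ) j).fderiv
    simp [pderiv, hproj, eq_comm]
  · exact pderiv_coord hf l a

theorem frameMatrix_eq_shearMatrix_mul (hf : DifferentiableAt ℂ f z) :
    frameMatrix f z = shearMatrix z * fromCols 1 (jetMatrix (jet f z)) := by
  rw [mul_fromCols, Matrix.mul_one]
  ext i α
  rcases i with u | l
  · rcases α with (v | j) | a <;>
      simp [frameMatrix, graphCoord, jetCoord, jet, shearMatrix, mul_apply, jetMatrix,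
        Fintype.sum_sum_type]
  · simp only [frameMatrix, of_apply, Sum.elim_inr, pderiv_graphCoord hf]
    rcases α with (_ | j) | a <;>
      simp [shearMatrix, mul_apply, jetMatrix, jet, Fintype.sum_sum_type, one_apply]

theorem graphMetric_apply (hU : IsOpen U) (hf : DifferentiableOn ℂ f U) (hz : z ∈ U)
    (i j : Fin n) :
    graphMetric f z i j =
      (frameMatrix f z * (frameMatrix f z)ᴴ) (Sum.inr i) (Sum.inr j) / normSq (graphCoord f) z -
      (frameMatrix f z * (frameMatrix f z)ᴴ) (Sum.inl ()) (Sum.inr j) *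
        (frameMatrix f z * (frameMatrix f z)ᴴ) (Sum.inr i) (Sum.inl ()) /
        (normSq (graphCoord f) z : ℂ) ^ 2 := by
  rw [graphMetric_eq_complexHessian, complexHessian_logNormSq hU (differentiableOn_graphCoord hf)
    (fun x _ => (normSq_graphCoord_pos f x).ne') hz, ofReal_normSq]
  simp [frameMatrix, mul_apply]

theorem det_gram_frameMatrix_add (hU : IsOpen U) (hf : DifferentiableOn ℂ f U) (hz : z ∈ U)
    (X : Matrix (Fin n) (Fin n) ℂ) :
    (frameMatrix f z * (frameMatrix f z)ᴴ + fromBlocks 0 0 0 X).det =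
      normSq (graphCoord f) z * ((normSq (graphCoord f) z : ℂ) • graphMetric f z + X).det := by
  have hN : (normSq (graphCoord f) z : ℂ) ≠ 0 :=
    Complex.ofReal_ne_zero.2 (normSq_graphCoord_pos f z).ne'
  rw [det_add_fromBlocks_zero (by rwa [frameMatrix_gram_inl_inl]), frameMatrix_gram_inl_inl]
  congr 3
  ext i j
  simp only [of_apply, Matrix.smul_apply, smul_eq_mul, graphMetric_apply hU hf hz]
  field_simp

theorem factorial_mul_det_gram_frameMatrix_add (hf : DifferentiableAt ℂ f z) (w : Fin n → ℂ) :
    ((n + 1).factorial : ℂ) * (frameMatrix f z * (frameMatrix f z)ᴴ +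
      fromBlocks 0 0 0 (vecMulVec w (star w))).det =
      ((normSq (plucker f) z + ∑ c, ‖augMinor f z c w‖ ^ 2 : ℝ) : ℂ) := by
  have hblocks : fromBlocks 0 0 0 (vecMulVec w (star w)) =
      vecMulVec (shearMatrix z *ᵥ shearVec z w) (star (shearMatrix z *ᵥ shearVec z w)) := by
    rw [shearMatrix_mulVec_shearVec]
    ext i j
    rcases i with i | i <;> rcases j with j | j <;> simp [vecMulVec_apply]
  have hgram : frameMatrix f z * (frameMatrix f z)ᴴ + fromBlocks 0 0 0 (vecMulVec w (star w)) =
      shearMatrix z * (augmented f z w * (augmented f z w)ᴴ) * (shearMatrix z)ᴴ := by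
    rw [hblocks, frameMatrix_eq_shearMatrix_mul hf, augmented,
      conjTranspose_fromCols_eq_fromRows_conjTranspose, fromCols_mul_fromRows, Matrix.mul_add,
      Matrix.add_mul, conjTranspose_mul]
    congr 1
    · simp only [Matrix.mul_assoc]
    · rw [vecMulVec_eq Unit, replicateCol_mulVec, Matrix.mul_assoc, Matrix.mul_assoc,
        Matrix.mul_assoc, ← conjTranspose_mul, ← replicateCol_mulVec]
      rfl
  have hcard : Fintype.card (Unit ⊕ Fin n) = n + 1 := by simp [add_comm]
  rw [hgram, det_mul, det_mul, det_conjTranspose, det_shearMatrix, star_one, mul_one, one_mul,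
    ← hcard, card_factorial_mul_det_mul_conjTranspose, sum_norm_sq_det_augmented]

theorem factorial_mul_det_gram_frameMatrix (hf : DifferentiableAt ℂ f z) :
    ((n + 1).factorial : ℂ) * (frameMatrix f z * (frameMatrix f z)ᴴ).det =
      normSq (plucker f) z := by
  simpa [augMinor_zero] using factorial_mul_det_gram_frameMatrix_add hf 0

theorem det_graphMetric (hU : IsOpen U) (hf : DifferentiableOn ℂ f U) (hz : z ∈ U) :
    (graphMetric f z).det = ((normSq (plucker f) z /
      ((n + 1).factorial * normSq (graphCoord f) z ^ (n + 1)) : ℝ) : ℂ) := by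
  have hplucker := factorial_mul_det_gram_frameMatrix (hf.differentiableAt (hU.mem_nhds hz))
  have hschur := det_gram_frameMatrix_add hU hf hz 0
  rw [fromBlocks_zero, add_zero, add_zero, det_smul, Fintype.card_fin] at hschur
  have hN : (normSq (graphCoord f) z : ℂ) ≠ 0 :=
    Complex.ofReal_ne_zero.2 (normSq_graphCoord_pos f z).ne'
  have hfac : ((n + 1).factorial : ℂ) ≠ 0 := mod_cast Nat.factorial_ne_zero _
  push_cast
  rw [← hplucker, hschur]
  field_simp
  ring

theorem isUnit_det_graphMetric (hU : IsOpen U) (hf : DifferentiableOn ℂ f U) (hz : z ∈ U) :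
    IsUnit (graphMetric f z).det := by
  have hN := normSq_graphCoord_pos f z
  have hT := normSq_plucker_pos f z
  rw [det_graphMetric hU hf hz, isUnit_iff_ne_zero, Complex.ofReal_ne_zero]
  positivity

theorem star_dotProduct_inv_graphMetric_mulVec (hU : IsOpen U) (hf : DifferentiableOn ℂ f U)
    (hz : z ∈ U) (w : Fin n → ℂ) :
    star w ⬝ᵥ ((graphMetric f z)⁻¹ *ᵥ w) = ((normSq (graphCoord f) z *
      (∑ c, ‖augMinor f z c w‖ ^ 2) / normSq (plucker f) z : ℝ) : ℂ) := by
  have hfz := hf.differentiableAt (hU.mem_nhds hz)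
  have hN : (normSq (graphCoord f) z : ℂ) ≠ 0 :=
    Complex.ofReal_ne_zero.2 (normSq_graphCoord_pos f z).ne'
  have hT : (normSq (plucker f) z : ℂ) ≠ 0 :=
    Complex.ofReal_ne_zero.2 (normSq_plucker_pos f z).ne'
  have hg := isUnit_det_graphMetric hU hf hz
  have hNg : IsUnit ((normSq (graphCoord f) z : ℂ) • graphMetric f z).det := by
    rw [det_smul]
    exact (hN.isUnit.pow _).mul hg
  have hinv : ((normSq (graphCoord f) z : ℂ) • graphMetric f z)⁻¹ =
      (normSq (graphCoord f) z : ℂ)⁻¹ • (graphMetric f z)⁻¹ :=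
    inv_smul' _ (Units.mk0 _ hN) hg
  have hbase := factorial_mul_det_gram_frameMatrix hfz
  have hadd := factorial_mul_det_gram_frameMatrix_add hfz w
  have hschur := det_gram_frameMatrix_add hU hf hz 0
  rw [fromBlocks_zero, add_zero, add_zero] at hschur
  rw [hschur] at hbase
  rw [det_gram_frameMatrix_add hU hf hz, det_add_vecMulVec hNg, hinv, smul_mulVec,
    dotProduct_smul, smul_eq_mul, Complex.ofReal_add] at hadd
  set s := star w ⬝ᵥ ((graphMetric f z)⁻¹ *ᵥ w)
  have hs : normSq (plucker f) z * ((normSq (graphCoord f) z : ℂ)⁻¹ * s) =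
      (∑ c, ‖augMinor f z c w‖ ^ 2 : ℝ) := by
    linear_combination hadd - (1 + (normSq (graphCoord f) z : ℂ)⁻¹ * s) * hbase
  rw [Complex.ofReal_div, Complex.ofReal_mul, ← hs]
  field_simp

end Graph

/-! ### The scalar curvature of a graph -/

section ScalarCurvature

/-- The squared norm of the second fundamental form of the graph of `f` in projective space,
written through the minors of `G ∧ ∂G` for the vector `G` of Plücker coordinates. -/
def sffNormSq {n k : ℕ} (f : EuclideanSpace ℂ (Fin n) → EuclideanSpace ℂ (Fin k))
    (z : EuclideanSpace ℂ (Fin n)) : ℝ :=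
  normSq (graphCoord f) z * (∑ p, ∑ q, ∑ c, ‖augMinor f z c (wedgeDeriv (plucker f) p q z)‖ ^ 2) /
    (2 * normSq (plucker f) z ^ 3)

variable {n k : ℕ} {f : EuclideanSpace ℂ (Fin n) → EuclideanSpace ℂ (Fin k)}
  {U : Set (EuclideanSpace ℂ (Fin n))} {z : EuclideanSpace ℂ (Fin n)}

theorem differentiableOn_plucker (hU : IsOpen U) (hf : DifferentiableOn ℂ f U) (p) :
    DifferentiableOn ℂ (plucker f p) U :=
  (differentiable_jetMinor p).comp_differentiableOn (differentiableOn_jet hU hf)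

theorem differentiableOn_augMinor (hU : IsOpen U) (hf : DifferentiableOn ℂ f U) (c)
    {w : EuclideanSpace ℂ (Fin n) → Fin n → ℂ} (hw : ∀ i, DifferentiableOn ℂ (fun x => w x i) U) :
    DifferentiableOn ℂ (fun x => augMinor f x c (w x)) U := by
  unfold augMinor
  split_ifs with h
  · refine differentiableOn_det fun i j => ?_
    change DifferentiableOn ℂ (fun x => augmented f x (w x) i (c j)) U
    rcases c j with α | u
    · exact (differentiable_fromCols_jetMatrix i α).comp_differentiableOn
        (differentiableOn_jet hU hf)
    · rcases i with _ | l
      · exact (DifferentiableOn.fun_sum fun j _ =>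
          (differentiableOn_euclidean.1 differentiableOn_id j).mul (hw j)).neg
      · exact hw l
  · exact differentiableOn_const _

theorem log_det_graphMetric (hU : IsOpen U) (hf : DifferentiableOn ℂ f U) (hz : z ∈ U) :
    Complex.log (graphMetric f z).det = logNormSq (plucker f) z -
      (n + 1) * logNormSq (graphCoord f) z - Real.log (n + 1).factorial := by
  have hT := normSq_plucker_pos f z
  have hN := normSq_graphCoord_pos f z
  have hfac : (0 : ℝ) < (n + 1).factorial := mod_cast Nat.factorial_pos _
  rw [det_graphMetric hU hf hz, ← Complex.ofReal_log (by positivity),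
    Real.log_div hT.ne' (by positivity), Real.log_mul hfac.ne' (by positivity), Real.log_pow]
  simp only [logNormSq]
  push_cast
  ring

theorem ricci_graphMetric (hU : IsOpen U) (hf : DifferentiableOn ℂ f U) (hz : z ∈ U) :
    ricci (graphMetric f) z =
      (n + 1 : ℂ) • graphMetric f z - complexHessian (logNormSq (plucker f)) z := by
  have hF := differentiableOn_graphCoord hf
  have hG := differentiableOn_plucker hU hf
  have hF0 : ∀ x ∈ U, normSq (graphCoord f) x ≠ 0 := fun x _ => (normSq_graphCoord_pos f x).ne'
  have hG0 : ∀ x ∈ U, normSq (plucker f) x ≠ 0 := fun x _ => (normSq_plucker_pos f x).ne'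
  have hdzbar : ∀ j, dzbar j (fun x => Complex.log (graphMetric f x).det) =ᶠ[𝓝 z] fun x =>
      dzbar j (logNormSq (plucker f)) x - (n + 1 : ℂ) * dzbar j (logNormSq (graphCoord f)) x := by
    intro j
    filter_upwards [hU.mem_nhds hz] with x hx
    have hUx := hU.mem_nhds hx
    rw [dzbar_congr (eventually_of_mem hUx fun y hy => log_det_graphMetric hU hf hy),
      dzbar_sub_const, dzbar_sub_const_mul
        (differentiableAt_logNormSq (fun p => (hG p).differentiableAt hUx) (hG0 x hx))
        (differentiableAt_logNormSq (fun p => (hF p).differentiableAt hUx) (hF0 x hx))]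
  ext i j
  rw [graphMetric_eq_complexHessian]
  simp only [ricci, complexHessian, Matrix.neg_apply, Matrix.sub_apply, Matrix.smul_apply,
    of_apply, smul_eq_mul]
  rw [dz_congr (hdzbar j), dz_sub_const_mul (differentiableAt_dzbar_logNormSq hU hG hG0 hz j)
    (differentiableAt_dzbar_logNormSq hU hF hF0 hz j)]
  ring

/-- The Gauss equation. -/
theorem scalarCurvature_graphMetric (hU : IsOpen U) (hf : DifferentiableOn ℂ f U) (hz : z ∈ U) :
    (n : ℂ) * (n + 1) - 1 / 4 * scalarCurvature (graphMetric f) z = sffNormSq f z := by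
  have hT : (normSq (plucker f) z : ℂ) ≠ 0 :=
    Complex.ofReal_ne_zero.2 (normSq_plucker_pos f z).ne'
  have htrace : ∀ w : Fin n → ℂ, ((graphMetric f z)⁻¹ * vecMulVec w (star w)).trace =
      ((normSq (graphCoord f) z * (∑ c, ‖augMinor f z c w‖ ^ 2) / normSq (plucker f) z : ℝ) : ℂ) :=
    fun w => by
      rw [mul_vecMulVec, trace_vecMulVec, dotProduct_comm,
        star_dotProduct_inv_graphMetric_mulVec hU hf hz]
  rw [scalarCurvature, ricci_graphMetric hU hf hz, complexHessian_logNormSq_eq_sum_vecMulVec hU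
    (differentiableOn_plucker hU hf) (fun x _ => (normSq_plucker_pos f x).ne') hz, Matrix.mul_sub,
    Matrix.mul_smul, Matrix.mul_smul, nonsing_inv_mul _ (isUnit_det_graphMetric hU hf hz),
    trace_sub, trace_smul, trace_smul, trace_one, Fintype.card_fin]
  simp only [Matrix.mul_sum, trace_sum, htrace]
  simp only [← Complex.ofReal_sum, ← Finset.sum_div, ← Finset.mul_sum]
  simp only [sffNormSq, smul_eq_mul, Complex.ofReal_div, Complex.ofReal_mul, Complex.ofReal_pow,
    Complex.ofReal_ofNat]
  field_simp
  ring

end ScalarCurvature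

/-! ### The pointwise bound on second derivatives -/

section Pointwise

variable {n k : ℕ} (f : EuclideanSpace ℂ (Fin n) → EuclideanSpace ℂ (Fin k))
  (z : EuclideanSpace ℂ (Fin n))

/-- The quantity `|D²f|²`. -/
def hessNormSq : ℝ := ∑ i, ∑ l, ‖pderiv i (pderiv l f) z‖ ^ 2

/-- The quantity `1 + |z|² + |f|² + |Df|²`, which the theorem bounds. -/
def jetNormSq : ℝ := 1 + ‖z‖ ^ 2 + ‖f z‖ ^ 2 + gradNormSq f z

theorem jetNormSq_eq_normSq_graphCoord_add :
    jetNormSq f z = normSq (graphCoord f) z + gradNormSq f z := by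
  rw [normSq_graphCoord, jetNormSq]

theorem jetNormSq_eq_one_add_norm_sq_jet : jetNormSq f z = 1 + ‖jet f z‖ ^ 2 := by
  simp [jetNormSq, gradNormSq, jet, pderiv, EuclideanSpace.norm_sq_eq, Fintype.sum_sum_type,
    Fintype.sum_prod_type, add_assoc]

theorem one_le_jetNormSq : 1 ≤ jetNormSq f z := by
  rw [jetNormSq_eq_one_add_norm_sq_jet]
  linarith [sq_nonneg ‖jet f z‖]

/-- The column selections for which `plucker f` is the constant `1`, respectively an entry of the
Jacobian matrix of `f`. -/
def selector (x : Option (Fin n × Fin k)) : Unit ⊕ Fin n → (Unit ⊕ Fin n) ⊕ Fin k :=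
  x.elim Sum.inl fun la => exchange id (Sum.inr la.1) la.2

theorem selector_injective (x : Option (Fin n × Fin k)) : (selector x).Injective := by
  rcases x with _ | la
  · exact Sum.inl_injective
  · exact exchange_injective Function.injective_id

theorem range_selector_injective :
    Function.Injective fun x : Option (Fin n × Fin k) => range (selector x) := by
  have hnone : ∀ la : Fin n × Fin k, range (selector none) ≠ range (selector (some la)) :=
    fun la h => (inl_mem_range_exchange (g := id) Function.injective_id).1
      (h ▸ mem_range_self (Sum.inr la.1)) rfl
  rintro (_ | ⟨l, a⟩) (_ | ⟨l', a'⟩) h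
  · rfl
  · exact absurd h (hnone _)
  · exact absurd h.symm (hnone _)
  · obtain ⟨hl, rfl⟩ := eq_and_eq_of_range_exchange_eq Function.injective_id h
    exact congrArg (fun l => some (l, a)) (Sum.inr_injective hl)

theorem plucker_selector_none : plucker f (selector none) = fun _ => 1 :=
  funext fun x => plucker_inl f x

theorem plucker_selector_some (la : Fin n × Fin k) :
    plucker f (selector (some la)) = fun x => pderiv la.1 f x la.2 :=
  funext fun _ => det_fromCols_submatrix_exchange (submatrix_id_id _) _ _ _

theorem plucker_comp_perm (p) (σ : Equiv.Perm (Unit ⊕ Fin n)) :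
    plucker f (p ∘ σ) = fun x => ((Equiv.Perm.sign σ : ℤ) : ℂ) * plucker f p x := by
  funext x
  rw [plucker, plucker, jetMinor, jetMinor, ← det_permute']
  rfl

theorem wedgeDeriv_comm {ι : Type*} (H : ι → EuclideanSpace ℂ (Fin n) → ℂ) (p q : ι) :
    wedgeDeriv H q p z = -wedgeDeriv H p q z :=
  funext fun _ => (neg_sub _ _).symm

/-- The column selections for which `augMinor` is an entry of the vector `w`. -/
def augSelector (i : Fin n) : Unit ⊕ Fin n → ((Unit ⊕ Fin n) ⊕ Fin k) ⊕ Unit :=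
  exchange Sum.inl (Sum.inr i) ()

theorem range_augSelector_injective :
    Function.Injective fun i : Fin n => range (augSelector (k := k) i) := fun _ _ h =>
  Sum.inr_injective (eq_and_eq_of_range_exchange_eq Sum.inl_injective h).1

theorem augMinor_augSelector (i : Fin n) (w : Fin n → ℂ) :
    augMinor f z (augSelector i) w = w i := by
  rw [augMinor, if_pos ⟨Sum.inr i, by simp [augSelector, exchange]⟩]
  exact det_fromCols_submatrix_exchange (by rfl) _ _ _

theorem norm_augMinor_comp_perm (c) (w : Fin n → ℂ) (σ : Equiv.Perm (Unit ⊕ Fin n)) :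
    ‖augMinor f z (c ∘ σ) w‖ = ‖augMinor f z c w‖ := by
  have hex : (∃ x, (c ∘ σ) x = Sum.inr ()) ↔ ∃ x, c x = Sum.inr () :=
    σ.exists_congr_left.trans (by simp)
  have hsub : (augmented f z w).submatrix id (c ∘ σ) =
      ((augmented f z w).submatrix id c).submatrix id σ := rfl
  simp only [augMinor, hex]
  split_ifs
  · rw [hsub, det_permute', norm_mul, norm_intCast_sign, one_mul]
  · rfl

theorem factorial_mul_sum_norm_sq_le_sum_norm_sq_augMinor (w : Fin n → ℂ) :
    ((n + 1).factorial : ℝ) * ∑ i, ‖w i‖ ^ 2 ≤ ∑ c, ‖augMinor f z c w‖ ^ 2 := by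
  have h := card_factorial_mul_sum_le_sum_functions (P := augSelector (n := n) (k := k))
    (fun _ => exchange_injective Sum.inl_injective) range_augSelector_injective
    (h := fun c => ‖augMinor f z c w‖ ^ 2) (fun _ => sq_nonneg _)
    (fun c σ => by simp only [norm_augMinor_comp_perm])
  simpa [augMinor_augSelector, add_comm] using h

variable {f z} {U : Set (EuclideanSpace ℂ (Fin n))}

theorem norm_wedgeDeriv_plucker_comp_perm (hU : IsOpen U) (hf : DifferentiableOn ℂ f U)
    (hz : z ∈ U) (p q) (σ : Equiv.Perm (Unit ⊕ Fin n)) (i : Fin n) :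
    ‖wedgeDeriv (plucker f) p (q ∘ σ) z i‖ = ‖wedgeDeriv (plucker f) p q z i‖ := by
  have hd : pderiv i (plucker f (q ∘ σ)) z =
      ((Equiv.Perm.sign σ : ℤ) : ℂ) * pderiv i (plucker f q) z := by
    rw [plucker_comp_perm, pderiv, fderiv_const_mul
      ((differentiableOn_plucker hU hf q).differentiableAt (hU.mem_nhds hz))]
    rfl
  have hw : wedgeDeriv (plucker f) p (q ∘ σ) z i =
      ((Equiv.Perm.sign σ : ℤ) : ℂ) * wedgeDeriv (plucker f) p q z i := by
    simp only [wedgeDeriv, hd]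
    rw [plucker_comp_perm]
    ring
  rw [hw, norm_mul, norm_intCast_sign, one_mul]

theorem wedgeDeriv_plucker_selector (hU : IsOpen U) (hf : DifferentiableOn ℂ f U) (hz : z ∈ U)
    (la : Fin n × Fin k) (i : Fin n) :
    wedgeDeriv (plucker f) (selector none) (selector (some la)) z i =
      pderiv i (pderiv la.1 f) z la.2 := by
  rw [← pderiv_coord ((differentiableOn_pderiv hU hf la.1).differentiableAt (hU.mem_nhds hz))]
  simp [wedgeDeriv, plucker_selector_none, plucker_selector_some, pderiv_const]

theorem hessNormSq_eq_sum_norm_sq_wedgeDeriv (hU : IsOpen U) (hf : DifferentiableOn ℂ f U)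
    (hz : z ∈ U) : hessNormSq f z = ∑ la : Fin n × Fin k, ∑ i,
      ‖wedgeDeriv (plucker f) (selector none) (selector (some la)) z i‖ ^ 2 := by
  simp only [wedgeDeriv_plucker_selector hU hf hz, hessNormSq, EuclideanSpace.norm_sq_eq,
    Fintype.sum_prod_type]
  rw [Finset.sum_comm]
  exact Finset.sum_congr rfl fun l _ => Finset.sum_comm

theorem two_mul_sq_factorial_mul_hessNormSq_le (hU : IsOpen U) (hf : DifferentiableOn ℂ f U)
    (hz : z ∈ U) : 2 * ((n + 1).factorial : ℝ) ^ 2 * hessNormSq f z ≤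
      ∑ p, ∑ q, ∑ i, ‖wedgeDeriv (plucker f) p q z i‖ ^ 2 := by
  set h := fun p q => ∑ i, ‖wedgeDeriv (plucker f) p q z i‖ ^ 2
  have h0 : ∀ p q, 0 ≤ h p q := fun p q => Finset.sum_nonneg fun _ _ => sq_nonneg _
  have hcomm : ∀ p q, h q p = h p q := fun p q => by simp [h, wedgeDeriv_comm z _ p q]
  calc 2 * ((n + 1).factorial : ℝ) ^ 2 * hessNormSq f z
      = ((n + 1).factorial : ℝ) ^ 2 * (2 * ∑ la, h (selector none) (selector (some la))) := by
        rw [hessNormSq_eq_sum_norm_sq_wedgeDeriv hU hf hz]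
        ring
    _ ≤ ((n + 1).factorial : ℝ) ^ 2 * ∑ x, ∑ y, h (selector x) (selector y) := by
        gcongr
        exact two_mul_sum_none_some_le_sum_sum (h := fun x y => h (selector x) (selector y))
          (fun x y => h0 _ _) fun x y => hcomm _ _
    _ ≤ ∑ p, ∑ q, h p q := by
        simpa [add_comm] using sq_card_factorial_mul_sum_sum_le_sum_sum_functions
          selector_injective range_selector_injective h0
          (fun p q σ => by simp only [h, norm_wedgeDeriv_plucker_comp_perm hU hf hz]) hcomm

theorem two_mul_factorial_pow_three_mul_hessNormSq_le (hU : IsOpen U)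
    (hf : DifferentiableOn ℂ f U) (hz : z ∈ U) :
    2 * ((n + 1).factorial : ℝ) ^ 3 * hessNormSq f z ≤
      ∑ p, ∑ q, ∑ c, ‖augMinor f z c (wedgeDeriv (plucker f) p q z)‖ ^ 2 := by
  calc 2 * ((n + 1).factorial : ℝ) ^ 3 * hessNormSq f z
      = ((n + 1).factorial : ℝ) * (2 * ((n + 1).factorial : ℝ) ^ 2 * hessNormSq f z) := by ring
    _ ≤ ((n + 1).factorial : ℝ) * ∑ p, ∑ q, ∑ i, ‖wedgeDeriv (plucker f) p q z i‖ ^ 2 := by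
        gcongr
        exact two_mul_sq_factorial_mul_hessNormSq_le hU hf hz
    _ = ∑ p, ∑ q, ((n + 1).factorial : ℝ) * ∑ i, ‖wedgeDeriv (plucker f) p q z i‖ ^ 2 := by
        simp only [Finset.mul_sum]
    _ ≤ ∑ p, ∑ q, ∑ c, ‖augMinor f z c (wedgeDeriv (plucker f) p q z)‖ ^ 2 := by
        gcongr
        exact factorial_mul_sum_norm_sq_le_sum_norm_sq_augMinor f z _

theorem trace_gram_frameMatrix_re (hf : DifferentiableAt ℂ f z) :
    (frameMatrix f z * (frameMatrix f z)ᴴ).trace.re = n + jetNormSq f z := by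
  have hderiv : ∀ l, (frameMatrix f z * (frameMatrix f z)ᴴ) (Sum.inr l) (Sum.inr l) =
      ((1 + ‖pderiv l f z‖ ^ 2 : ℝ) : ℂ) := fun l => by
    simp [frameMatrix, mul_apply, pderiv_graphCoord hf, Fintype.sum_sum_type,
      EuclideanSpace.norm_sq_eq, Complex.mul_conj, Complex.normSq_eq_norm_sq, apply_ite]
  have hgrad : gradNormSq f z = ∑ l, ‖pderiv l f z‖ ^ 2 := rfl
  simp only [trace, diag_apply, Fintype.sum_sum_type, Finset.univ_unique, Finset.sum_singleton,
    PUnit.default_eq_unit, frameMatrix_gram_inl_inl, hderiv, ← Complex.ofReal_sum,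
    ← Complex.ofReal_add, Complex.ofReal_re, Finset.sum_add_distrib, ← hgrad,
    jetNormSq_eq_normSq_graphCoord_add]
  simp
  ring

theorem normSq_plucker_le (hf : DifferentiableAt ℂ f z) :
    normSq (plucker f) z ≤ (n + 1).factorial * jetNormSq f z ^ (n + 1) := by
  have hj := one_le_jetNormSq f z
  have hdet : ((n + 1).factorial : ℝ) * (frameMatrix f z * (frameMatrix f z)ᴴ).det.re =
      normSq (plucker f) z := by
    simpa using congrArg Complex.re (factorial_mul_det_gram_frameMatrix hf)
  have hamgm :=
    det_re_le_trace_re_div_card_pow (posSemidef_self_mul_conjTranspose (frameMatrix f z))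
  have hcard : Fintype.card (Unit ⊕ Fin n) = n + 1 := by simp [add_comm]
  rw [trace_gram_frameMatrix_re hf, hcard] at hamgm
  have hmean : (n + jetNormSq f z) / (n + 1 : ℕ) ≤ jetNormSq f z := by
    rw [div_le_iff₀ (by positivity)]
    push_cast
    nlinarith [(Nat.cast_nonneg n : (0 : ℝ) ≤ n)]
  rw [← hdet]
  gcongr
  exact hamgm.trans (by gcongr)

theorem hessNormSq_le (hU : IsOpen U) (hf : DifferentiableOn ℂ f U) (hz : z ∈ U) :
    hessNormSq f z ≤ sffNormSq f z * jetNormSq f z ^ (3 * n + 3) := by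
  have hS := two_mul_factorial_pow_three_mul_hessNormSq_le hU hf hz
  have hT := normSq_plucker_pos f z
  have hsff : normSq (graphCoord f) z * (∑ p, ∑ q, ∑ c,
      ‖augMinor f z c (wedgeDeriv (plucker f) p q z)‖ ^ 2) =
        2 * normSq (plucker f) z ^ 3 * sffNormSq f z := by
    rw [sffNormSq]
    field_simp
  have hS0 : 0 ≤ ∑ p, ∑ q, ∑ c, ‖augMinor f z c (wedgeDeriv (plucker f) p q z)‖ ^ 2 :=
    Finset.sum_nonneg fun p _ => Finset.sum_nonneg fun q _ => Finset.sum_nonneg fun c _ =>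
      sq_nonneg _
  generalize ∑ p, ∑ q, ∑ c, ‖augMinor f z c (wedgeDeriv (plucker f) p q z)‖ ^ 2 = S at hS hsff hS0
  have hN := one_le_normSq_graphCoord f z
  set m : ℝ := ((n + 1).factorial : ℝ)
  have : 0 < m := by positivity
  have hsff0 : 0 ≤ sffNormSq f z := by
    have : 0 ≤ 2 * normSq (plucker f) z ^ 3 * sffNormSq f z := hsff ▸ by positivity
    exact (mul_nonneg_iff_of_pos_left (by positivity)).1 this
  have hmain : 2 * m ^ 3 * hessNormSq f z ≤
      2 * m ^ 3 * (sffNormSq f z * jetNormSq f z ^ (3 * n + 3)) := by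
    calc 2 * m ^ 3 * hessNormSq f z
        ≤ S := hS
      _ ≤ normSq (graphCoord f) z * S := le_mul_of_one_le_left hS0 hN
      _ = 2 * normSq (plucker f) z ^ 3 * sffNormSq f z := hsff
      _ ≤ 2 * (m * jetNormSq f z ^ (n + 1)) ^ 3 * sffNormSq f z := by
          gcongr
          exact normSq_plucker_le (hf.differentiableAt (hU.mem_nhds hz))
      _ = 2 * m ^ 3 * (sffNormSq f z * jetNormSq f z ^ (3 * n + 3)) := by ring
  exact le_of_mul_le_mul_left hmain (by positivity)

end Pointwise

/-! ### The radial differential inequality -/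

theorem le_one_sub_rpow_of_deriv_le {J : ℝ → ℝ} {p c : ℝ} (hp : 0 < p) (hpc : p * c < 1)
    (hJ0 : J 0 = 1) (hJ : ∀ s ∈ Icc (0 : ℝ) 1, 0 < J s)
    (hdiff : ∀ s ∈ Icc (0 : ℝ) 1, DifferentiableAt ℝ J s)
    (hderiv : ∀ s ∈ Icc (0 : ℝ) 1, deriv J s ≤ c * J s ^ (1 + p)) :
    J 1 ≤ (1 - p * c) ^ (-p⁻¹) := by
  have hv : ∀ s ∈ Icc (0 : ℝ) 1, HasDerivAt (fun s => J s ^ (-p) + p * c * s)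
      (deriv J s * -p * J s ^ (-p - 1) + p * c * 1) s := fun s hs =>
    ((hdiff s hs).hasDerivAt.rpow_const (Or.inl (hJ s hs).ne')).add
      ((hasDerivAt_id s).const_mul (p * c))
  have hv' : ∀ s ∈ Icc (0 : ℝ) 1, 0 ≤ deriv J s * -p * J s ^ (-p - 1) + p * c * 1 := fun s hs => by
    have h : deriv J s * J s ^ (-p - 1) ≤ c := by
      calc deriv J s * J s ^ (-p - 1) ≤ c * J s ^ (1 + p) * J s ^ (-p - 1) :=
            mul_le_mul_of_nonneg_right (hderiv s hs) (Real.rpow_nonneg (hJ s hs).le _)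
        _ = c := by
            rw [mul_assoc, ← Real.rpow_add (hJ s hs), show 1 + p + (-p - 1) = 0 by ring,
              Real.rpow_zero, mul_one]
    nlinarith
  have hmono : MonotoneOn (fun s => J s ^ (-p) + p * c * s) (Icc 0 1) :=
    monotoneOn_of_deriv_nonneg (convex_Icc 0 1)
      (fun s hs => (hv s hs).continuousAt.continuousWithinAt)
      (fun s hs => (hv s (interior_subset hs)).differentiableAt.differentiableWithinAt)
      (fun s hs => (hv s (interior_subset hs)).deriv ▸ hv' s (interior_subset hs))
  have h01 := hmono (left_mem_Icc.2 zero_le_one) (right_mem_Icc.2 zero_le_one) zero_le_one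
  simp only [hJ0, Real.one_rpow, mul_zero, add_zero, mul_one] at h01
  have h1 := hJ 1 (right_mem_Icc.2 zero_le_one)
  calc J 1 = (J 1 ^ (-p)) ^ (-p⁻¹) := by
        rw [← Real.rpow_mul h1.le, neg_mul_neg, mul_inv_cancel₀ hp.ne', Real.rpow_one]
    _ ≤ (1 - p * c) ^ (-p⁻¹) := Real.rpow_le_rpow_of_nonpos (by linarith) (by linarith)
        (by simpa using hp.le)

theorem extRadius_inv (n : ℕ) (Λ : ℝ) : (extRadius n Λ)⁻¹ = (3 * n + 2) * √(Λ + 1) :=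
  inv_inv _

theorem extRadius_pos (n : ℕ) {Λ : ℝ} (hΛ : 0 ≤ Λ) : 0 < extRadius n Λ := by
  have : 0 < √(Λ + 1) := Real.sqrt_pos.2 (by linarith)
  rw [extRadius]
  positivity

section Radial

variable {n k : ℕ} {f : EuclideanSpace ℂ (Fin n) → EuclideanSpace ℂ (Fin k)}
  {z : EuclideanSpace ℂ (Fin n)}

theorem fderiv_apply_eq_sum_pderiv {F : Type*} [NormedAddCommGroup F] [NormedSpace ℂ F]
    (g : EuclideanSpace ℂ (Fin n) → F) (x v : EuclideanSpace ℂ (Fin n)) :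
    fderiv ℂ g x v = ∑ l, v l • pderiv l g x := by
  conv_lhs => rw [← (EuclideanSpace.basisFun (Fin n) ℂ).sum_repr v]
  simp [pderiv]

theorem norm_fderiv_apply_sq_le {F : Type*} [NormedAddCommGroup F] [NormedSpace ℂ F]
    (g : EuclideanSpace ℂ (Fin n) → F) (x v : EuclideanSpace ℂ (Fin n)) :
    ‖fderiv ℂ g x v‖ ^ 2 ≤ ‖v‖ ^ 2 * ∑ l, ‖pderiv l g x‖ ^ 2 := by
  calc ‖fderiv ℂ g x v‖ ^ 2 ≤ (∑ l, ‖v l‖ * ‖pderiv l g x‖) ^ 2 := by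
        rw [fderiv_apply_eq_sum_pderiv]
        gcongr
        exact (norm_sum_le _ _).trans_eq (Finset.sum_congr rfl fun l _ => norm_smul _ _)
    _ ≤ ‖v‖ ^ 2 * ∑ l, ‖pderiv l g x‖ ^ 2 := by
        rw [EuclideanSpace.norm_sq_eq]
        exact Finset.sum_mul_sq_le_sq_mul_sq _ _ _

theorem fderiv_jet_apply {U : Set (EuclideanSpace ℂ (Fin n))} (hU : IsOpen U)
    (hf : DifferentiableOn ℂ f U) (hz : z ∈ U) (v : EuclideanSpace ℂ (Fin n)) :
    fderiv ℂ (jet f) z v = WithLp.toLp 2 (Sum.elim v (Sum.elim (fderiv ℂ f z v) fun la =>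
      fderiv ℂ (pderiv la.1 f) z v la.2)) := by
  have hnhds := hU.mem_nhds hz
  have hjet := (differentiableOn_jet hU hf).differentiableAt hnhds
  have hcoord : ∀ α, fderiv ℂ (jet f) z v α = fderiv ℂ (fun x => jet f x α) z v := fun α =>
    congrArg (fun T => T v) ((EuclideanSpace.proj α).hasFDerivAt.comp z
      hjet.hasFDerivAt).fderiv.symm
  ext α
  rw [hcoord]
  rcases α with i | a | la
  · exact congrArg (fun T => T v) (EuclideanSpace.proj i : _ →L[ℂ] ℂ).fderiv
  · exact congrArg (fun T => T v) ((EuclideanSpace.proj a).hasFDerivAt.comp z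
      (hf.differentiableAt hnhds).hasFDerivAt).fderiv
  · exact congrArg (fun T => T v) ((EuclideanSpace.proj la.2).hasFDerivAt.comp z
      ((differentiableOn_pderiv hU hf la.1).differentiableAt hnhds).hasFDerivAt).fderiv

theorem norm_fderiv_jet_apply_sq_le {U : Set (EuclideanSpace ℂ (Fin n))} (hU : IsOpen U)
    (hf : DifferentiableOn ℂ f U) (hz : z ∈ U) (v : EuclideanSpace ℂ (Fin n)) :
    ‖fderiv ℂ (jet f) z v‖ ^ 2 ≤ ‖v‖ ^ 2 * (1 + gradNormSq f z + hessNormSq f z) := by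
  calc ‖fderiv ℂ (jet f) z v‖ ^ 2
      = ‖v‖ ^ 2 + ‖fderiv ℂ f z v‖ ^ 2 + ∑ l, ‖fderiv ℂ (pderiv l f) z v‖ ^ 2 := by
        simp [fderiv_jet_apply hU hf hz, EuclideanSpace.norm_sq_eq, Fintype.sum_sum_type,
          Fintype.sum_prod_type, add_assoc]
    _ ≤ ‖v‖ ^ 2 + ‖v‖ ^ 2 * ∑ l, ‖pderiv l f z‖ ^ 2 +
          ∑ l, ‖v‖ ^ 2 * ∑ i, ‖pderiv i (pderiv l f) z‖ ^ 2 := by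
        gcongr <;> exact norm_fderiv_apply_sq_le _ z v
    _ = ‖v‖ ^ 2 * (1 + gradNormSq f z + hessNormSq f z) := by
        rw [hessNormSq, Finset.sum_comm, ← Finset.mul_sum, gradNormSq]
        simp only [pderiv]
        ring

theorem norm_fderiv_jet_apply_le {U : Set (EuclideanSpace ℂ (Fin n))} (hU : IsOpen U)
    (hf : DifferentiableOn ℂ f U) (hz : z ∈ U) {Λ : ℝ} (hΛ : sffNormSq f z ≤ Λ)
    (v : EuclideanSpace ℂ (Fin n)) :
    ‖fderiv ℂ (jet f) z v‖ ≤
      ‖v‖ * √(Λ + 1) * jetNormSq f z ^ ((3 * (n : ℝ) + 3) / 2) := by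
  have hJ := one_le_jetNormSq f z
  have hgrad : 1 + gradNormSq f z ≤ jetNormSq f z ^ (3 * n + 3) := by
    refine le_trans ?_ (le_self_pow₀ hJ (by omega))
    rw [jetNormSq]
    nlinarith [sq_nonneg ‖z‖, sq_nonneg ‖f z‖]
  have hhess : hessNormSq f z ≤ Λ * jetNormSq f z ^ (3 * n + 3) :=
    (hessNormSq_le hU hf hz).trans (by gcongr)
  have hsqrt : √(jetNormSq f z ^ (3 * n + 3)) = jetNormSq f z ^ ((3 * (n : ℝ) + 3) / 2) := by
    rw [Real.sqrt_eq_rpow, ← Real.rpow_natCast, ← Real.rpow_mul (by positivity)]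
    push_cast
    ring_nf
  calc ‖fderiv ℂ (jet f) z v‖ ≤ √(‖v‖ ^ 2 * (1 + gradNormSq f z + hessNormSq f z)) :=
        Real.le_sqrt_of_sq_le (norm_fderiv_jet_apply_sq_le hU hf hz v)
    _ ≤ √(‖v‖ ^ 2 * ((Λ + 1) * jetNormSq f z ^ (3 * n + 3))) := by
        gcongr
        linarith
    _ = ‖v‖ * √(Λ + 1) * jetNormSq f z ^ ((3 * (n : ℝ) + 3) / 2) := by
        rw [Real.sqrt_mul (sq_nonneg _), Real.sqrt_sq (norm_nonneg _),
          Real.sqrt_mul' _ (by positivity), hsqrt, mul_assoc]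

theorem jetNormSq_zero (hf0 : f 0 = 0) (hDf0 : fderiv ℂ f 0 = 0) : jetNormSq f 0 = 1 := by
  simp [jetNormSq, gradNormSq, hf0, hDf0]

theorem hasDerivAt_jetNormSq_smul {ρ : ℝ} (hf : DifferentiableOn ℂ f (ball 0 ρ)) {s : ℝ}
    (hs : s • z ∈ ball 0 ρ) : HasDerivAt (fun s : ℝ => jetNormSq f (s • z))
      (2 * inner ℝ (jet f (s • z)) (fderiv ℂ (jet f) (s • z) z)) s := by
  have hjet := (differentiableOn_jet isOpen_ball hf).differentiableAt (isOpen_ball.mem_nhds hs)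
  have hray : HasDerivAt (fun s : ℝ => s • z) z s := by
    simpa using (hasDerivAt_id s).smul_const z
  simp only [jetNormSq_eq_one_add_norm_sq_jet]
  exact ((hjet.hasFDerivAt.restrictScalars ℝ).comp_hasDerivAt s hray).norm_sq.const_add 1

theorem deriv_jetNormSq_smul_le {ρ Λ : ℝ} (hf : DifferentiableOn ℂ f (ball 0 ρ)) {s : ℝ}
    (hs : s • z ∈ ball 0 ρ) (hΛ : sffNormSq f (s • z) ≤ Λ) :
    deriv (fun s : ℝ => jetNormSq f (s • z)) s ≤
      2 * ‖z‖ * √(Λ + 1) * jetNormSq f (s • z) ^ (1 + (3 * (n : ℝ) + 2) / 2) := by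
  rw [(hasDerivAt_jetNormSq_smul hf hs).deriv]
  have hJ : 0 < jetNormSq f (s • z) := zero_lt_one.trans_le (one_le_jetNormSq f _)
  have hjet : ‖jet f (s • z)‖ ≤ jetNormSq f (s • z) ^ (1 / 2 : ℝ) := by
    rw [← Real.sqrt_eq_rpow]
    exact Real.le_sqrt_of_sq_le (by linarith [jetNormSq_eq_one_add_norm_sq_jet f (s • z)])
  calc 2 * inner ℝ (jet f (s • z)) (fderiv ℂ (jet f) (s • z) z)
      ≤ 2 * (‖jet f (s • z)‖ * ‖fderiv ℂ (jet f) (s • z) z‖) := by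
        gcongr
        exact real_inner_le_norm _ _
    _ ≤ 2 * (jetNormSq f (s • z) ^ (1 / 2 : ℝ) *
          (‖z‖ * √(Λ + 1) * jetNormSq f (s • z) ^ ((3 * (n : ℝ) + 3) / 2))) := by
        gcongr
        exact norm_fderiv_jet_apply_le isOpen_ball hf hs hΛ z
    _ = 2 * ‖z‖ * √(Λ + 1) * (jetNormSq f (s • z) ^ (1 / 2 : ℝ) *
          jetNormSq f (s • z) ^ ((3 * (n : ℝ) + 3) / 2)) := by ring
    _ = 2 * ‖z‖ * √(Λ + 1) * jetNormSq f (s • z) ^ (1 + (3 * (n : ℝ) + 2) / 2) := by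
        rw [← Real.rpow_add hJ]
        ring_nf

theorem jetNormSq_le_of_sffNormSq_le {ρ Λ : ℝ} (hΛ : 0 ≤ Λ)
    (hf : DifferentiableOn ℂ f (ball 0 ρ)) (hf0 : f 0 = 0) (hDf0 : fderiv ℂ f 0 = 0)
    (hsff : ∀ x ∈ ball 0 ρ, sffNormSq f x ≤ Λ) (hz : z ∈ ball 0 ρ)
    (hzΛ : ‖z‖ < extRadius n Λ) :
    jetNormSq f z ≤ (1 - (extRadius n Λ)⁻¹ * ‖z‖) ^ (-(2 / (3 * (n : ℝ) + 2))) := by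
  have hmem : ∀ s ∈ Icc (0 : ℝ) 1, s • z ∈ ball 0 ρ := fun s hs => by
    rw [mem_ball_zero_iff] at hz ⊢
    rw [norm_smul, Real.norm_of_nonneg hs.1]
    exact (mul_le_of_le_one_left (norm_nonneg _) hs.2).trans_lt hz
  have hpc : (3 * (n : ℝ) + 2) / 2 * (2 * ‖z‖ * √(Λ + 1)) = (extRadius n Λ)⁻¹ * ‖z‖ := by
    rw [extRadius_inv]
    ring
  have hlt : (extRadius n Λ)⁻¹ * ‖z‖ < 1 := by
    rwa [inv_mul_lt_one₀ (extRadius_pos n hΛ)]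
  have h := le_one_sub_rpow_of_deriv_le (J := fun s : ℝ => jetNormSq f (s • z))
    (p := (3 * (n : ℝ) + 2) / 2) (c := 2 * ‖z‖ * √(Λ + 1)) (by positivity) (hpc ▸ hlt)
    (by simp [jetNormSq_zero hf0 hDf0])
    (fun s _ => zero_lt_one.trans_le (one_le_jetNormSq f _))
    (fun s hs => (hasDerivAt_jetNormSq_smul hf (hmem s hs)).differentiableAt)
    (fun s hs => deriv_jetNormSq_smul_le hf (hmem s hs) (hsff _ (hmem s hs)))
  simpa only [one_smul, hpc, inv_div] using h

end Radial

/-! ### The curvature equation as a linear relation -/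

section Contraction

variable {E H H' K : Type*} [NormedAddCommGroup E] [NormedSpace ℂ E]
  [NormedAddCommGroup H] [InnerProductSpace ℂ H]
  [NormedAddCommGroup H'] [InnerProductSpace ℂ H']
  [NormedAddCommGroup K] [InnerProductSpace ℂ K] [FiniteDimensional ℂ K]

theorem exists_linear_contraction_of_add {a : E → H} {a' : E → H'} {b : E → K} {U : Set E}
    (hU : IsOpen U) (hUc : Convex ℝ U) (ha : DifferentiableOn ℂ a U)
    (ha' : DifferentiableOn ℂ a' U) (hb : DifferentiableOn ℂ b U)
    (hab : ∀ z ∈ U, ‖a z‖ ^ 2 + ‖a' z‖ ^ 2 = ‖b z‖ ^ 2) :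
    ∃ L : K →ₗ[ℂ] H, (∀ z ∈ U, L (b z) = a z) ∧ ∀ v, ‖L v‖ ≤ ‖v‖ := by
  have hsum : DifferentiableOn ℂ (fun z => WithLp.toLp 2 (a z, a' z)) U :=
    (WithLp.prodContinuousLinearEquiv 2 ℂ H H').symm.differentiable.comp_differentiableOn
      (ha.prodMk ha')
  obtain ⟨L, hL, hL'⟩ := exists_linear_contraction hU hUc hsum hb fun z hz => by
    rw [← sq_eq_sq₀ (norm_nonneg _) (norm_nonneg _), WithLp.prod_norm_sq_eq_of_L2]
    exact hab z hz
  refine ⟨(WithLp.fstL 2 ℂ H H').toLinearMap ∘ₗ L, fun z hz => ?_, fun v => ?_⟩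
  · exact congrArg WithLp.fst (hL z hz)
  · exact (le_of_sq_le_sq (by
      rw [WithLp.prod_norm_sq_eq_of_L2]
      exact le_add_of_nonneg_right (sq_nonneg _)) (norm_nonneg _)).trans (hL' v)

end Contraction

section CurvatureEquation

theorem sum_norm_sq_mul {ι κ : Type*} [Fintype ι] [Fintype κ] (u : ι → ℂ) (v : κ → ℂ) :
    ∑ x : ι × κ, ‖u x.1 * v x.2‖ ^ 2 = (∑ i, ‖u i‖ ^ 2) * ∑ j, ‖v j‖ ^ 2 := by
  simp only [norm_mul, mul_pow, Fintype.sum_prod_type, Finset.sum_mul_sum]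

theorem sum_norm_sq_sqrt_mul {ι κ : Type*} [Fintype ι] [Fintype κ] {c : ℝ} (hc : 0 ≤ c)
    (u : ι → ℂ) (v : κ → ℂ) : ∑ x : ι × κ, ‖(√c : ℂ) * (u x.1 * v x.2)‖ ^ 2 =
      c * ((∑ i, ‖u i‖ ^ 2) * ∑ j, ‖v j‖ ^ 2) := by
  simp only [norm_mul (√c : ℂ), mul_pow (‖(√c : ℂ)‖), ← Finset.mul_sum, sum_norm_sq_mul]
  rw [Complex.norm_real, Real.norm_eq_abs, sq_abs, Real.sq_sqrt hc]

open scoped MatrixOrder Matrix.Norms.L2Operator in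
theorem exists_star_dotProduct_mulVec_eq {ι : Type*} [Fintype ι] [DecidableEq ι] {Λ : ℝ}
    {A : Matrix ι ι ℂ} (hA : ((Λ : ℂ) • (1 : Matrix ι ι ℂ) - A).PosSemidef) :
    ∃ B : Matrix ι ι ℂ, ∀ v, star v ⬝ᵥ (A *ᵥ v) =
      ((Λ * ∑ i, ‖v i‖ ^ 2 - ∑ i, ‖(B *ᵥ v) i‖ ^ 2 : ℝ) : ℂ) := by
  obtain ⟨B, hB⟩ : ∃ B : Matrix ι ι ℂ, (Λ : ℂ) • 1 - A = Bᴴ * B :=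
    CStarAlgebra.nonneg_iff_eq_star_mul_self.1 hA.nonneg
  refine ⟨B, fun v => ?_⟩
  have hself : ∀ u : ι → ℂ, star u ⬝ᵥ u = ((∑ i, ‖u i‖ ^ 2 : ℝ) : ℂ) := fun u => by
    simp [dotProduct, Complex.conj_mul']
  have hBv : star v ⬝ᵥ ((Bᴴ * B) *ᵥ v) = ((∑ i, ‖(B *ᵥ v) i‖ ^ 2 : ℝ) : ℂ) := by
    rw [← hself, ← mulVec_mulVec, dotProduct_mulVec, star_mulVec]
  rw [← hB, sub_mulVec, smul_mulVec, one_mulVec, dotProduct_sub, dotProduct_smul, hself] at hBv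
  rw [Complex.ofReal_sub, ← hBv]
  simp

variable {n k : ℕ} (f : EuclideanSpace ℂ (Fin n) → EuclideanSpace ℂ (Fin k))
  (z : EuclideanSpace ℂ (Fin n))

/-- Indices for the components of `sffVec`. -/
abbrev SffIndex (n k : ℕ) : Type :=
  ((Unit ⊕ Fin n) ⊕ Fin k) × ((Unit ⊕ Fin n) ⊕ Fin k) ×
    (Unit ⊕ Fin n → (Unit ⊕ Fin n) ⊕ Fin k) × (Unit ⊕ Fin n → (Unit ⊕ Fin n) ⊕ Fin k) ×
    (Unit ⊕ Fin n → ((Unit ⊕ Fin n) ⊕ Fin k) ⊕ Unit)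

/-- Indices for the components of `G ⊗ G ⊗ G`, where `G` is the vector of Plücker coordinates. -/
abbrev CubeIndex (n k : ℕ) : Type :=
  (Unit ⊕ Fin n → (Unit ⊕ Fin n) ⊕ Fin k) × (Unit ⊕ Fin n → (Unit ⊕ Fin n) ⊕ Fin k) ×
    (Unit ⊕ Fin n → (Unit ⊕ Fin n) ⊕ Fin k)

/-- The second fundamental form of the graph, multiplied by denominators so that its components
are holomorphic. -/
def sffVec : EuclideanSpace ℂ (SffIndex n k) :=
  WithLp.toLp 2 fun x => graphCoord f x.1 z * (graphCoord f x.2.1 z *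
    augMinor f z x.2.2.2.2 (wedgeDeriv (plucker f) x.2.2.1 x.2.2.2.1 z))

/-- The components of `G ⊗ G ⊗ G` as functions of the jet. -/
def jetCube (w : JetSpace n k) (x : CubeIndex n k) : ℂ :=
  jetMinor x.1 w * (jetMinor x.2.1 w * jetMinor x.2.2 w)

/-- The vector `√(2Λ) G ⊗ G ⊗ G ⊗ (1, z, f)` as a function of the jet. -/
def polVec (Λ : ℝ) (w : JetSpace n k) :
    EuclideanSpace ℂ (CubeIndex n k × ((Unit ⊕ Fin n) ⊕ Fin k)) :=
  WithLp.toLp 2 fun x => √(2 * Λ) * (jetCube w x.1 * jetCoord x.2 w)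

theorem norm_sq_sffVec : ‖sffVec f z‖ ^ 2 =
    2 * normSq (graphCoord f) z * normSq (plucker f) z ^ 3 * sffNormSq f z := by
  have hT := normSq_plucker_pos f z
  have h : ‖sffVec f z‖ ^ 2 = normSq (graphCoord f) z ^ 2 *
      ∑ p, ∑ q, ∑ c, ‖augMinor f z c (wedgeDeriv (plucker f) p q z)‖ ^ 2 := by
    simp only [sffVec, EuclideanSpace.norm_sq_eq, norm_mul, mul_pow, Fintype.sum_prod_type,
      ← Finset.mul_sum, ← Finset.sum_mul]
    rw [pow_two, mul_assoc]
    rfl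
  rw [h, sffNormSq]
  field_simp

theorem sum_norm_sq_jetCube : ∑ x, ‖jetCube (jet f z) x‖ ^ 2 = normSq (plucker f) z ^ 3 := by
  simp only [jetCube]
  rw [sum_norm_sq_mul (fun p => jetMinor p (jet f z)) fun x : _ × _ =>
      jetMinor x.1 (jet f z) * jetMinor x.2 (jet f z),
    sum_norm_sq_mul (fun p => jetMinor p (jet f z)) fun p => jetMinor p (jet f z), pow_succ',
    pow_two]
  rfl

theorem norm_sq_polVec_jet {Λ : ℝ} (hΛ : 0 ≤ Λ) : ‖polVec Λ (jet f z)‖ ^ 2 =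
    2 * normSq (graphCoord f) z * normSq (plucker f) z ^ 3 * Λ := by
  have hcoord : ∑ α, ‖jetCoord α (jet f z)‖ ^ 2 = normSq (graphCoord f) z := rfl
  rw [EuclideanSpace.norm_sq_eq]
  simp only [polVec]
  rw [sum_norm_sq_sqrt_mul (by linarith) (jetCube (jet f z)) fun α => jetCoord α (jet f z),
    sum_norm_sq_jetCube, hcoord]
  ring

theorem sum_norm_sq_graphVec : ∑ s, ‖graphVec f z s‖ ^ 2 = normSq (graphCoord f) z := by
  rw [Fin.sum_univ_succ, Fin.sum_univ_add, normSq_graphCoord, EuclideanSpace.norm_sq_eq,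
    EuclideanSpace.norm_sq_eq]
  simp [graphVec, add_assoc]

theorem differentiable_jetCube (x : CubeIndex n k) :
    Differentiable ℂ fun w : JetSpace n k => jetCube w x :=
  (differentiable_jetMinor _).mul ((differentiable_jetMinor _).mul (differentiable_jetMinor _))

theorem differentiable_polVec (Λ : ℝ) : Differentiable ℂ (polVec (n := n) (k := k) Λ) :=
  differentiable_euclidean.2 fun x =>
    ((differentiable_jetCube x.1).mul (differentiable_jetCoord x.2)).const_mul _

variable {f z} {U : Set (EuclideanSpace ℂ (Fin n))}

theorem differentiableOn_sffVec (hU : IsOpen U) (hf : DifferentiableOn ℂ f U) :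
    DifferentiableOn ℂ (sffVec f) U :=
  differentiableOn_euclidean.2 fun _ =>
    (differentiableOn_graphCoord hf _).mul ((differentiableOn_graphCoord hf _).mul
      (differentiableOn_augMinor hU hf _ fun i =>
        ((differentiableOn_plucker hU hf _).mul
          (differentiableOn_pderiv hU (differentiableOn_plucker hU hf _) i)).sub
        ((differentiableOn_plucker hU hf _).mul
          (differentiableOn_pderiv hU (differentiableOn_plucker hU hf _) i))))

theorem differentiableOn_graphVec (hf : DifferentiableOn ℂ f U) (s) :
    DifferentiableOn ℂ (fun z => graphVec f z s) U := by
  refine Fin.cases (differentiableOn_const _) (Fin.addCases (fun j => ?_) fun a => ?_) s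
  · simpa [graphVec] using differentiableOn_euclidean.1 differentiableOn_id j
  · simpa [graphVec] using differentiableOn_euclidean.1 hf a

/-- Clearing denominators in the curvature equation gives
`‖sffVec‖² + ‖√2 G ⊗ G ⊗ G ⊗ B (1, z, f)‖² = ‖polVec‖²`, where `Λ - A = B* B`. -/
theorem exists_linear_sffVec {Λ : ℝ} (hΛ : 0 ≤ Λ) (hU : IsOpen U) (hUc : Convex ℝ U)
    (hf : DifferentiableOn ℂ f U) {A : Matrix (Fin (n + k + 1)) (Fin (n + k + 1)) ℂ}
    (hA : ((Λ : ℂ) • (1 : Matrix (Fin (n + k + 1)) (Fin (n + k + 1)) ℂ) - A).PosSemidef)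
    (heq : ∀ z ∈ U, (n : ℂ) * (n + 1) - 1 / 4 * scalarCurvature (graphMetric f) z =
      star (graphVec f z) ⬝ᵥ (A *ᵥ graphVec f z) / ((1 + ‖z‖ ^ 2 + ‖f z‖ ^ 2 : ℝ) : ℂ)) :
    ∃ L : EuclideanSpace ℂ (CubeIndex n k × ((Unit ⊕ Fin n) ⊕ Fin k)) →ₗ[ℂ]
        EuclideanSpace ℂ (SffIndex n k),
      (∀ z ∈ U, L (polVec Λ (jet f z)) = sffVec f z) ∧ ∀ v, ‖L v‖ ≤ ‖v‖ := by
  obtain ⟨B, hB⟩ := exists_star_dotProduct_mulVec_eq hA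
  let rem : EuclideanSpace ℂ (Fin n) → EuclideanSpace ℂ (CubeIndex n k × Fin (n + k + 1)) :=
    fun z => WithLp.toLp 2 fun x => √2 * (jetCube (jet f z) x.1 * (B *ᵥ graphVec f z) x.2)
  have hrem : DifferentiableOn ℂ rem U := by
    refine differentiableOn_euclidean.2 fun x => (DifferentiableOn.mul
      ((differentiable_jetCube x.1).comp_differentiableOn (differentiableOn_jet hU hf))
      ?_).const_mul _
    simp only [mulVec, dotProduct]
    exact DifferentiableOn.fun_sum fun s _ => (differentiableOn_graphVec hf s).const_mul _
  refine exists_linear_contraction_of_add hU hUc (differentiableOn_sffVec hU hf) hrem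
    ((differentiable_polVec Λ).comp_differentiableOn (differentiableOn_jet hU hf)) fun z hz => ?_
  have hN := normSq_graphCoord_pos f z
  have hsff : sffNormSq f z = (Λ * normSq (graphCoord f) z - ∑ s, ‖(B *ᵥ graphVec f z) s‖ ^ 2) /
      normSq (graphCoord f) z := by
    have h := heq z hz
    rw [scalarCurvature_graphMetric hU hf hz, hB, sum_norm_sq_graphVec, ← normSq_graphCoord,
      ← Complex.ofReal_div] at h
    exact Complex.ofReal_injective h
  have hremz : ‖rem z‖ ^ 2 =
      2 * (normSq (plucker f) z ^ 3 * ∑ s, ‖(B *ᵥ graphVec f z) s‖ ^ 2) := by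
    rw [EuclideanSpace.norm_sq_eq, ← sum_norm_sq_jetCube]
    exact sum_norm_sq_sqrt_mul zero_le_two _ _
  rw [hremz, norm_sq_sffVec, norm_sq_polVec_jet f z hΛ, hsff]
  field_simp
  ring

theorem sffNormSq_le_of_norm_sffVec_le {Λ : ℝ} (hΛ : 0 ≤ Λ)
    (h : ‖sffVec f z‖ ≤ ‖polVec Λ (jet f z)‖) : sffNormSq f z ≤ Λ := by
  have hN := normSq_graphCoord_pos f z
  have hT := normSq_plucker_pos f z
  have hsq := pow_le_pow_left₀ (norm_nonneg _) h 2
  rw [norm_sq_sffVec, norm_sq_polVec_jet f z hΛ] at hsq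
  exact le_of_mul_le_mul_left hsq (by positivity)

/-- The index of a second derivative of `f` among the components of `sffVec`. -/
def hessIndex (i l : Fin n) (a : Fin k) : SffIndex n k :=
  (Sum.inl (Sum.inl ()), Sum.inl (Sum.inl ()), selector none, selector (some (l, a)),
    augSelector i)

theorem sffVec_hessIndex (hU : IsOpen U) (hf : DifferentiableOn ℂ f U) (hz : z ∈ U)
    (i l : Fin n) (a : Fin k) : sffVec f z (hessIndex i l a) = pderiv i (pderiv l f) z a := by
  rw [← wedgeDeriv_plucker_selector hU hf hz (l, a) i]
  simp [sffVec, hessIndex, graphCoord, jetCoord, augMinor_augSelector]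

end CurvatureEquation

/-! ### Taylor series and extension to larger balls -/

section IteratedDeriv

variable {F : Type*} [NormedAddCommGroup F] [NormedSpace ℂ F] [CompleteSpace F] {h : ℂ → F}
  {ρ δ B : ℝ}

theorem differentiableOn_iteratedDeriv {U : Set ℂ} (hU : IsOpen U) (hh : DifferentiableOn ℂ h U)
    (j : ℕ) : DifferentiableOn ℂ (iteratedDeriv j h) U := by
  induction j with
  | zero => simpa using hh
  | succ j ih =>
    rw [iteratedDeriv_succ]
    exact ih.deriv hU

theorem norm_iteratedDeriv_zero_mul_pow_le (hρ : 0 < ρ) (hh : DifferentiableOn ℂ h (ball 0 ρ))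
    (hB : ∀ t ∈ ball (0 : ℂ) ρ, ‖h t‖ ≤ B) (m : ℕ) :
    ‖iteratedDeriv m h 0‖ * ρ ^ m ≤ m.factorial * B := by
  have htend : Tendsto (fun s : ℝ => ‖iteratedDeriv m h 0‖ * s ^ m) (𝓝[<] ρ)
      (𝓝 (‖iteratedDeriv m h 0‖ * ρ ^ m)) :=
    (continuous_const.mul (continuous_id.pow m)).continuousAt.tendsto.mono_left nhdsWithin_le_nhds
  refine le_of_tendsto htend ?_
  filter_upwards [Ioo_mem_nhdsLT hρ] with s hs
  have hsub : closedBall (0 : ℂ) s ⊆ ball 0 ρ := closedBall_subset_ball hs.2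
  rw [← le_div_iff₀ (pow_pos hs.1 m)]
  exact Complex.norm_iteratedDeriv_le_of_forall_mem_sphere_norm_le m hs.1
    (hh.mono (closure_ball_subset_closedBall.trans hsub)).diffContOnCl
    fun t ht => hB t (hsub (sphere_subset_closedBall ht))

/-- Factorial bounds for all derivatives on a disc bound the Taylor coefficients at its centre as
if `h` were holomorphic on a disc larger by `δ`: apply the Cauchy estimate to the derivative of
order `N - m` and sum over `m` with the binomial theorem. -/
theorem norm_iteratedDeriv_zero_mul_add_pow_le (hρ : 0 < ρ) (hδ : 0 < δ)
    (hh : DifferentiableOn ℂ h (ball 0 ρ))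
    (hB : ∀ j, ∀ t ∈ ball (0 : ℂ) ρ, ‖iteratedDeriv j h t‖ * δ ^ j ≤ B * j.factorial) (N : ℕ) :
    ‖iteratedDeriv N h 0‖ * (ρ + δ) ^ N ≤ N.factorial * (B * (N + 1)) := by
  have hterm : ∀ m ∈ Finset.range (N + 1),
      ‖iteratedDeriv N h 0‖ * (ρ ^ m * δ ^ (N - m) * N.choose m) ≤ N.factorial * B := fun m hm => by
    have hmN : m ≤ N := Nat.lt_succ_iff.1 (Finset.mem_range.1 hm)
    have hcauchy := norm_iteratedDeriv_zero_mul_pow_le hρ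
      (differentiableOn_iteratedDeriv isOpen_ball hh (N - m))
      (B := B * (N - m).factorial / δ ^ (N - m))
      (fun t ht => (le_div_iff₀ (by positivity)).2 (hB _ t ht)) m
    have hiter : iteratedDeriv m (iteratedDeriv (N - m) h) = iteratedDeriv N h := by
      rw [iteratedDeriv_eq_iterate, iteratedDeriv_eq_iterate, iteratedDeriv_eq_iterate,
        ← Function.iterate_add_apply, Nat.add_sub_cancel' hmN]
    rw [hiter, mul_div_assoc', le_div_iff₀ (by positivity)] at hcauchy
    calc ‖iteratedDeriv N h 0‖ * (ρ ^ m * δ ^ (N - m) * N.choose m)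
        = N.choose m * (‖iteratedDeriv N h 0‖ * ρ ^ m * δ ^ (N - m)) := by ring
      _ ≤ N.choose m * (m.factorial * (B * (N - m).factorial)) := by gcongr
      _ = (N.choose m * m.factorial * (N - m).factorial : ℕ) * B := by
          push_cast
          ring
      _ = N.factorial * B := by rw [Nat.choose_mul_factorial_mul_factorial hmN]
  calc ‖iteratedDeriv N h 0‖ * (ρ + δ) ^ N
      = ∑ m ∈ Finset.range (N + 1),
          ‖iteratedDeriv N h 0‖ * (ρ ^ m * δ ^ (N - m) * N.choose m) := by
        rw [add_pow, Finset.mul_sum]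
    _ ≤ ∑ _m ∈ Finset.range (N + 1), N.factorial * B := Finset.sum_le_sum hterm
    _ = N.factorial * (B * (N + 1)) := by
        simp
        ring

end IteratedDeriv

section TaylorSeries

variable {E F : Type*} [NormedAddCommGroup E] [NormedSpace ℂ E] [NormedAddCommGroup F]
  [NormedSpace ℂ F]

/-- The homogeneous part of degree `N` of the Taylor series of `f` at the origin. -/
def taylorTerm (f : E → F) (N : ℕ) (z : E) : F :=
  (N.factorial : ℂ)⁻¹ • iteratedFDeriv ℂ N f 0 fun _ => z

/-- The sum of the Taylor series of `f` at the origin (`0` where the series diverges). It is the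
maximal holomorphic continuation of `f` to a ball centred at the origin, which makes the existence
of a continuation to a given ball a property of one function. -/
def taylorSum (f : E → F) (z : E) : F := ∑' N, taylorTerm f N z

theorem taylorTerm_congr {f g : E → F} (h : f =ᶠ[𝓝 0] g) : taylorTerm f = taylorTerm g := by
  funext N z
  rw [taylorTerm, (h.iteratedFDeriv ℂ N).eq_of_nhds, taylorTerm]

theorem taylorSum_congr {f g : E → F} (h : f =ᶠ[𝓝 0] g) : taylorSum f = taylorSum g := by
  funext z
  rw [taylorSum, taylorTerm_congr h, taylorSum]

theorem differentiable_taylorTerm (f : E → F) (N : ℕ) : Differentiable ℂ (taylorTerm f N) :=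
  fun z => DifferentiableAt.const_smul (((iteratedFDeriv ℂ N f 0).hasFDerivAt
    fun _ => z).differentiableAt.comp z (differentiableAt_pi.2 fun _ => differentiableAt_id)) _

theorem taylorTerm_smul (f : E → F) (N : ℕ) (c : ℂ) (z : E) :
    taylorTerm f N (c • z) = c ^ N • taylorTerm f N z := by
  rw [taylorTerm, (iteratedFDeriv ℂ N f 0).map_smul_univ (fun _ => c) fun _ => z, smul_comm]
  simp [taylorTerm]

theorem norm_taylorTerm_le {f : E → F} {N : ℕ} {C : ℝ}
    (hC : ∀ z : E, ‖z‖ ≤ 1 → ‖taylorTerm f N z‖ ≤ C) (z : E) :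
    ‖taylorTerm f N z‖ ≤ C * ‖z‖ ^ N := by
  have hz : z = (‖z‖ : ℂ) • ((‖z‖ : ℂ)⁻¹ • z) := by
    rcases eq_or_ne z 0 with rfl | hz
    · simp
    · rw [smul_inv_smul₀ (by simpa using hz)]
  have hunit : ‖(‖z‖ : ℂ)⁻¹ • z‖ ≤ 1 := by
    rw [norm_smul, norm_inv, Complex.norm_real, norm_norm]
    exact inv_mul_le_one
  calc ‖taylorTerm f N z‖ = ‖z‖ ^ N * ‖taylorTerm f N ((‖z‖ : ℂ)⁻¹ • z)‖ := by
        conv_lhs => rw [hz, taylorTerm_smul]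
        rw [norm_smul, norm_pow, Complex.norm_real, norm_norm]
    _ ≤ ‖z‖ ^ N * C := by
        gcongr
        exact hC _ hunit
    _ = C * ‖z‖ ^ N := mul_comm _ _

theorem differentiableOn_taylorSum [CompleteSpace F] {f : E → F} {ρ B : ℝ} (hρ : 0 < ρ)
    (hB : ∀ N : ℕ, ∀ z : E, ‖z‖ ≤ 1 → ‖taylorTerm f N z‖ * ρ ^ N ≤ B * (N + 1)) :
    DifferentiableOn ℂ (taylorSum f) (ball 0 ρ) := by
  intro z hz
  obtain ⟨s, hzs, hsρ⟩ := exists_between (mem_ball_zero_iff.1 hz)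
  have hs : 0 ≤ s := (norm_nonneg z).trans hzs.le
  have hB0 : 0 ≤ B := by simpa using (mul_nonneg (norm_nonneg _) (by simp)).trans (hB 0 0 (by simp))
  have hterm : ∀ N : ℕ, ∀ x ∈ ball (0 : E) s,
      ‖taylorTerm f N x‖ ≤ B * (N ^ 1 * (s / ρ) ^ N + (s / ρ) ^ N) := fun N x hx => by
    calc ‖taylorTerm f N x‖ ≤ B * (N + 1) / ρ ^ N * ‖x‖ ^ N :=
          norm_taylorTerm_le (fun y hy => (le_div_iff₀ (by positivity)).2 (hB N y hy)) x
      _ ≤ B * (N + 1) / ρ ^ N * s ^ N := by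
          gcongr
          exact (mem_ball_zero_iff.1 hx).le
      _ = B * (N ^ 1 * (s / ρ) ^ N + (s / ρ) ^ N) := by
          rw [div_pow]
          ring
  have hq : ‖s / ρ‖ < 1 := by
    rwa [Real.norm_of_nonneg (by positivity), div_lt_one hρ]
  have hsum : Summable fun N : ℕ => B * (N ^ 1 * (s / ρ) ^ N + (s / ρ) ^ N) :=
    ((summable_pow_mul_geometric_of_norm_lt_one 1 hq).add
      (summable_geometric_of_norm_lt_one hq)).mul_left B
  have hdiff : DifferentiableOn ℂ (taylorSum f) (ball 0 s) :=
    differentiableOn_of_tendstoUniformlyOn isOpen_ball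
      (Eventually.of_forall fun t => DifferentiableOn.fun_sum fun N _ =>
        (differentiable_taylorTerm f N).differentiableOn)
      (tendstoUniformlyOn_tsum hsum hterm)
  exact (hdiff.differentiableAt
    (isOpen_ball.mem_nhds (mem_ball_zero_iff.2 hzs))).differentiableWithinAt

theorem mapsTo_smul_ball {ρ : ℝ} {z : E} (hz : ‖z‖ ≤ 1) :
    MapsTo (fun t : ℂ => t • z) (ball 0 ρ) (ball 0 ρ) := fun t ht => by
  rw [mem_ball_zero_iff] at ht ⊢
  calc ‖t • z‖ = ‖t‖ * ‖z‖ := norm_smul _ _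
    _ ≤ ‖t‖ := mul_le_of_le_one_right (norm_nonneg _) hz
    _ < ρ := ht

theorem differentiableOn_comp_smul {f : E → F} {ρ : ℝ} (hf : DifferentiableOn ℂ f (ball 0 ρ))
    {z : E} (hz : ‖z‖ ≤ 1) : DifferentiableOn ℂ (fun t : ℂ => f (t • z)) (ball 0 ρ) :=
  hf.comp (differentiable_id.smul_const z).differentiableOn (mapsTo_smul_ball hz)

variable [FiniteDimensional ℂ E] [CompleteSpace F] {f : E → F} {ρ : ℝ}

theorem iteratedDeriv_line (hρ : 0 < ρ) (hf : DifferentiableOn ℂ f (ball 0 ρ)) (N : ℕ) (z : E) :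
    iteratedDeriv N (fun t : ℂ => f (t • z)) 0 = (N.factorial : ℂ) • taylorTerm f N z := by
  let g : ℂ →L[ℂ] E := ContinuousLinearMap.toSpanSingleton ℂ z
  have hU : IsOpen (g ⁻¹' ball (0 : E) ρ) := isOpen_ball.preimage g.continuous
  have h0 : (0 : ℂ) ∈ g ⁻¹' ball (0 : E) ρ := by simp [hρ]
  have hcomp := g.iteratedFDerivWithin_comp_right
    (contDiffOn_of_differentiableOn isOpen_ball hf N)
    isOpen_ball.uniqueDiffOn hU.uniqueDiffOn h0 le_rfl
  rw [iteratedFDerivWithin_of_isOpen N hU h0, iteratedFDerivWithin_of_isOpen N isOpen_ball h0]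
    at hcomp
  have hline : (fun t : ℂ => f (t • z)) = f ∘ g := rfl
  rw [iteratedDeriv_eq_iteratedFDeriv, taylorTerm,
    smul_inv_smul₀ (by exact_mod_cast N.factorial_ne_zero), hline, hcomp]
  simp [g]

theorem hasSum_taylorTerm (hf : DifferentiableOn ℂ f (ball 0 ρ)) {z : E} (hz : z ∈ ball 0 ρ) :
    HasSum (fun N => taylorTerm f N z) (f z) := by
  obtain ⟨s, hzs, hsρ⟩ := exists_between (mem_ball_zero_iff.1 hz)
  have hs : 0 < s := (norm_nonneg z).trans_lt hzs
  have hsz : (s : ℂ) • (s : ℂ)⁻¹ • z = z := smul_inv_smul₀ (by exact_mod_cast hs.ne') z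
  have hunit : ‖(s : ℂ)⁻¹ • z‖ ≤ 1 := by
    rw [norm_smul, norm_inv, Complex.norm_real, Real.norm_of_nonneg hs.le]
    exact inv_mul_le_one_of_le₀ hzs.le hs.le
  have hsum := Complex.hasSum_taylorSeries_on_ball (differentiableOn_comp_smul hf hunit)
    (z := (s : ℂ)) (by simpa [abs_of_pos hs] using hsρ)
  simp only [sub_zero, hsz, iteratedDeriv_line (hs.trans hsρ) hf] at hsum
  refine hsum.congr_fun fun N => ?_
  rw [smul_comm ((s : ℂ) ^ N), inv_smul_smul₀ (by exact_mod_cast N.factorial_ne_zero),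
    ← taylorTerm_smul, hsz]

theorem taylorSum_eqOn {g : E → F} (hg : DifferentiableOn ℂ g (ball 0 ρ)) (h : g =ᶠ[𝓝 0] f) :
    EqOn (taylorSum f) g (ball 0 ρ) := fun z hz => by
  rw [← taylorSum_congr h]
  exact (hasSum_taylorTerm hg hz).tsum_eq

theorem taylorSum_eventuallyEq (hρ : 0 < ρ) (hf : DifferentiableOn ℂ f (ball 0 ρ)) :
    taylorSum f =ᶠ[𝓝 0] f :=
  (taylorSum_eqOn hf EventuallyEq.rfl).eventuallyEq_of_mem (ball_mem_nhds 0 hρ)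

theorem eqOn_ball_of_eventuallyEq {g : E → F} (hf : DifferentiableOn ℂ f (ball 0 ρ))
    (hg : DifferentiableOn ℂ g (ball 0 ρ)) (h : g =ᶠ[𝓝 0] f) : EqOn g f (ball 0 ρ) :=
  (taylorSum_eqOn hg h).symm.trans (taylorSum_eqOn hf EventuallyEq.rfl)

theorem differentiableOn_taylorSum_add {δ B : ℝ} (hρ : 0 < ρ) (hδ : 0 < δ)
    (hf : DifferentiableOn ℂ f (ball 0 ρ))
    (hB : ∀ z : E, ‖z‖ ≤ 1 → ∀ t ∈ ball (0 : ℂ) ρ, ∀ j,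
      ‖iteratedDeriv j (fun t : ℂ => f (t • z)) t‖ * δ ^ j ≤ B * j.factorial) :
    DifferentiableOn ℂ (taylorSum f) (ball 0 (ρ + δ)) :=
  differentiableOn_taylorSum (add_pos hρ hδ) fun N z hz => by
    have hN := norm_iteratedDeriv_zero_mul_add_pow_le hρ hδ (differentiableOn_comp_smul hf hz)
      (fun j t ht => hB z hz t ht j) N
    rw [iteratedDeriv_line hρ hf, norm_smul, Complex.norm_natCast, mul_assoc] at hN
    exact le_of_mul_le_mul_left hN (by positivity)

end TaylorSeries

/-! ### Derivatives of bounded solutions of holomorphic differential equations -/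

section LieDerivative

variable {W F : Type*} [NormedAddCommGroup W] [NormedSpace ℂ W] [FiniteDimensional ℂ W]
  [NormedAddCommGroup F] [NormedSpace ℂ F] [CompleteSpace F] {X : W → W} {g : W → F}
  {Y : ℂ → W} {A C M ρ : ℝ}

/-- The `j`-th Lie derivative of the observable `g` along the vector field `X`; along an integral
curve of `X` it is the `j`-th derivative of `g`. -/
def lieIter {W F : Type*} [NormedAddCommGroup W] [NormedSpace ℂ W] [NormedAddCommGroup F]
    [NormedSpace ℂ F] (X : W → W) (g : W → F) : ℕ → W → F
  | 0 => g
  | j + 1 => fun w => fderiv ℂ (lieIter X g j) w (X w)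

theorem differentiable_lieIter (hX : Differentiable ℂ X) (hg : Differentiable ℂ g) (j : ℕ) :
    Differentiable ℂ (lieIter X g j) := by
  induction j with
  | zero => exact hg
  | succ j ih =>
    have hsmooth : ContDiff ℂ 2 (lieIter X g j) :=
      contDiffOn_univ.1 (contDiffOn_of_differentiableOn isOpen_univ ih.differentiableOn 2)
    exact ((hsmooth.fderiv_right (m := 1) (by norm_num)).differentiable (by norm_num)).clm_apply hX

/-- Each Lie derivative costs one Cauchy estimate on a ball of radius `1 / K`. -/
theorem norm_lieIter_le (hX : Differentiable ℂ X) (hg : Differentiable ℂ g)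
    (hC : ∀ w, ‖w‖ ≤ M + 1 → ‖X w‖ ≤ C) (hA : ∀ w, ‖w‖ ≤ M + 1 → ‖g w‖ ≤ A) {K : ℕ} (hK : 0 < K)
    (j : ℕ) : ∀ w, ‖w‖ ≤ M + 1 - j / K → ‖lieIter X g j w‖ ≤ A * (2 * K * C) ^ j := by
  have : (0 : ℝ) < K := by exact_mod_cast hK
  induction j with
  | zero =>
    intro w hw
    simpa [lieIter] using hA w (by simpa using hw)
  | succ j ih =>
    intro w hw
    have hw' : ‖w‖ ≤ M + 1 := hw.trans (sub_le_self _ (by positivity))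
    have hball : ∀ x ∈ ball w (1 / K : ℝ), ‖lieIter X g j x‖ ≤ A * (2 * K * C) ^ j := by
      intro x hx
      refine ih x ?_
      rw [mem_ball_iff_norm] at hx
      have htri : ‖x‖ ≤ ‖w‖ + ‖x - w‖ := norm_le_insert' x w |>.trans_eq (by ring)
      have hstep : ((j + 1 : ℕ) : ℝ) / K = j / K + 1 / K := by
        push_cast
        ring
      linarith
    have hfderiv : ‖fderiv ℂ (lieIter X g j) w‖ ≤ 2 * (A * (2 * K * C) ^ j) / (1 / K) :=
      norm_fderiv_le_of_forall_norm_le (by positivity)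
        (differentiable_lieIter hX hg j).differentiableOn hball
    calc ‖lieIter X g (j + 1) w‖ ≤ ‖fderiv ℂ (lieIter X g j) w‖ * ‖X w‖ :=
          ContinuousLinearMap.le_opNorm _ _
      _ ≤ 2 * (A * (2 * K * C) ^ j) / (1 / K) * C :=
          mul_le_mul hfderiv (hC w hw') (norm_nonneg _) ((norm_nonneg _).trans hfderiv)
      _ = A * (2 * K * C) ^ (j + 1) := by
          field_simp
          ring

theorem iteratedDeriv_eq_lieIter (hX : Differentiable ℂ X) (hg : Differentiable ℂ g)
    (hY : ∀ t ∈ ball (0 : ℂ) ρ, HasDerivAt Y (X (Y t)) t) (j : ℕ) :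
    EqOn (iteratedDeriv j fun t => g (Y t)) (fun t => lieIter X g j (Y t)) (ball 0 ρ) := by
  induction j with
  | zero => exact fun t _ => by simp [lieIter]
  | succ j ih =>
    intro t ht
    rw [iteratedDeriv_succ, (ih.eventuallyEq_of_mem (isOpen_ball.mem_nhds ht)).deriv_eq]
    exact ((differentiable_lieIter hX hg j (Y t)).hasFDerivAt.comp_hasDerivAt t (hY t ht)).deriv

theorem norm_iteratedDeriv_le_of_ode (hX : Differentiable ℂ X) (hg : Differentiable ℂ g)
    (hC : ∀ w, ‖w‖ ≤ M + 1 → ‖X w‖ ≤ C) (hA : ∀ w, ‖w‖ ≤ M + 1 → ‖g w‖ ≤ A)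
    (hY : ∀ t ∈ ball (0 : ℂ) ρ, HasDerivAt Y (X (Y t)) t)
    (hM : ∀ t ∈ ball (0 : ℂ) ρ, ‖Y t‖ ≤ M) (j : ℕ) {t : ℂ} (ht : t ∈ ball (0 : ℂ) ρ) :
    ‖iteratedDeriv j (fun t => g (Y t)) t‖ ≤ A * j.factorial * (2 * Real.exp 1 * C) ^ j := by
  have hYt : ‖Y t‖ ≤ M + 1 := (hM t ht).trans (by linarith)
  rcases Nat.eq_zero_or_pos j with rfl | hj
  · simpa using hA _ hYt
  have hC0 : 0 ≤ C := (norm_nonneg _).trans (hC _ hYt)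
  have hA0 : 0 ≤ A := (norm_nonneg _).trans (hA _ hYt)
  have hj' : (0 : ℝ) < j := by exact_mod_cast hj
  have hexp : (j : ℝ) ^ j ≤ Real.exp 1 ^ j * j.factorial := by
    rw [← Real.exp_nat_mul, mul_one, ← div_le_iff₀ (by positivity)]
    exact Real.pow_div_factorial_le_exp _ hj'.le _
  calc ‖iteratedDeriv j (fun t => g (Y t)) t‖ = ‖lieIter X g j (Y t)‖ := by
        rw [iteratedDeriv_eq_lieIter hX hg hY j ht]
    _ ≤ A * (2 * j * C) ^ j :=
        norm_lieIter_le hX hg hC hA hj j _ (by simpa [hj'.ne'] using hM t ht)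
    _ = A * (2 * C) ^ j * j ^ j := by ring
    _ ≤ A * (2 * C) ^ j * (Real.exp 1 ^ j * j.factorial) := by gcongr
    _ = A * j.factorial * (2 * Real.exp 1 * C) ^ j := by ring

end LieDerivative

/-! ### Continuation of solutions of the curvature equation -/

section Continuation

variable {n k : ℕ}

/-- The vector field on the jet space that the jets of a solution of `L (polVec Λ (jet f z)) =
sffVec f z` follow along the ray in direction `v`: the components of `sffVec` include the second
derivatives of `f`, so the equation expresses them in terms of the first jet. -/
def jetField (Λ : ℝ) (L : EuclideanSpace ℂ (CubeIndex n k × ((Unit ⊕ Fin n) ⊕ Fin k)) →ₗ[ℂ]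
    EuclideanSpace ℂ (SffIndex n k)) (v : EuclideanSpace ℂ (Fin n)) (w : JetSpace n k) :
    JetSpace n k :=
  WithLp.toLp 2 <| Sum.elim (fun j => v j) <|
    Sum.elim (fun a => ∑ i, v i * w (Sum.inr (Sum.inr (i, a)))) fun la =>
      ∑ i, v i * L (polVec Λ w) (hessIndex i la.1 la.2)

variable {Λ : ℝ} {L : EuclideanSpace ℂ (CubeIndex n k × ((Unit ⊕ Fin n) ⊕ Fin k)) →ₗ[ℂ]
    EuclideanSpace ℂ (SffIndex n k)}

theorem differentiable_uncurry_jetField :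
    Differentiable ℂ fun p : EuclideanSpace ℂ (Fin n) × JetSpace n k => jetField Λ L p.1 p.2 := by
  have hpol : Differentiable ℂ fun p : EuclideanSpace ℂ (Fin n) × JetSpace n k =>
      L (polVec Λ p.2) :=
    L.toContinuousLinearMap.differentiable.comp ((differentiable_polVec Λ).comp differentiable_snd)
  refine differentiable_euclidean.2 ?_
  rintro (j | a | la) <;> simp only [jetField, Sum.elim_inl, Sum.elim_inr]
  · fun_prop
  · fun_prop
  · exact Differentiable.fun_sum fun i _ => Differentiable.mul (by fun_prop)
      (differentiable_euclidean.1 hpol _)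

theorem differentiable_jetField (v : EuclideanSpace ℂ (Fin n)) :
    Differentiable ℂ (jetField Λ L v) :=
  differentiable_uncurry_jetField.comp ((differentiable_const v).prodMk differentiable_id)

variable (Λ L) in
theorem exists_norm_jetField_le (M : ℝ) :
    ∃ C, 0 ≤ C ∧ ∀ v : EuclideanSpace ℂ (Fin n), ‖v‖ ≤ 1 →
      ∀ w : JetSpace n k, ‖w‖ ≤ M → ‖jetField Λ L v w‖ ≤ C := by
  obtain ⟨C, hC⟩ := ((isCompact_closedBall (0 : EuclideanSpace ℂ (Fin n)) 1).prod
    (isCompact_closedBall (0 : JetSpace n k) M)).exists_bound_of_continuousOn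
    (differentiable_uncurry_jetField (Λ := Λ) (L := L)).continuous.continuousOn
  exact ⟨max C 0, le_max_right _ _, fun v hv w hw => (hC (v, w)
    ⟨mem_closedBall_zero_iff.2 hv, mem_closedBall_zero_iff.2 hw⟩).trans (le_max_left _ _)⟩

variable {f : EuclideanSpace ℂ (Fin n) → EuclideanSpace ℂ (Fin k)}

theorem fderiv_jet_apply_eq_jetField {U : Set (EuclideanSpace ℂ (Fin n))} (hU : IsOpen U)
    (hf : DifferentiableOn ℂ f U) {z : EuclideanSpace ℂ (Fin n)} (hz : z ∈ U)
    (hL : L (polVec Λ (jet f z)) = sffVec f z) (v : EuclideanSpace ℂ (Fin n)) :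
    fderiv ℂ (jet f) z v = jetField Λ L v (jet f z) := by
  rw [fderiv_jet_apply hU hf hz, jetField, hL]
  congr 2
  simp only [fderiv_apply_eq_sum_pderiv, sffVec_hessIndex hU hf hz]
  congr 1
  · funext a
    simp [jet]
  · funext la
    simp

theorem hasDerivAt_jet_smul {U : Set (EuclideanSpace ℂ (Fin n))} (hU : IsOpen U)
    (hf : DifferentiableOn ℂ f U) {v : EuclideanSpace ℂ (Fin n)} {t : ℂ} (ht : t • v ∈ U)
    (hL : L (polVec Λ (jet f (t • v))) = sffVec f (t • v)) :
    HasDerivAt (fun t : ℂ => jet f (t • v)) (jetField Λ L v (jet f (t • v))) t := by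
  rw [← fderiv_jet_apply_eq_jetField hU hf ht hL]
  have hline : HasDerivAt (fun t : ℂ => t • v) v t := by
    simpa using (hasDerivAt_id t).smul_const v
  exact ((differentiableOn_jet hU hf).differentiableAt
    (hU.mem_nhds ht)).hasFDerivAt.comp_hasDerivAt t hline

theorem jet_congr {g : EuclideanSpace ℂ (Fin n) → EuclideanSpace ℂ (Fin k)}
    {z : EuclideanSpace ℂ (Fin n)} (h : f =ᶠ[𝓝 z] g) : jet f z = jet g z := by
  simp only [jet, pderiv, h.eq_of_nhds, h.fderiv_eq]

theorem sffVec_congr {g : EuclideanSpace ℂ (Fin n) → EuclideanSpace ℂ (Fin k)}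
    {z : EuclideanSpace ℂ (Fin n)} (h : f =ᶠ[𝓝 z] g) : sffVec f z = sffVec g z := by
  have hjet : jet f =ᶠ[𝓝 z] jet g := h.eventuallyEq_nhds.mono fun _ => jet_congr
  have hplucker : ∀ p, plucker f p =ᶠ[𝓝 z] plucker g p := fun p => hjet.fun_comp (jetMinor p)
  have hwedge : ∀ p q, wedgeDeriv (plucker f) p q z = wedgeDeriv (plucker g) p q z := fun p q => by
    funext i
    simp only [wedgeDeriv, pderiv, (hplucker _).eq_of_nhds, (hplucker _).fderiv_eq]
  simp only [sffVec, graphCoord, augMinor, augmented, hjet.eq_of_nhds, hwedge]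

variable (Λ L f) in
/-- `f` vanishes to second order at the origin and satisfies the linearised curvature equation
near the origin. -/
structure IsSolutionGerm : Prop where
  map_zero : f 0 = 0
  fderiv_zero : fderiv ℂ f 0 = 0
  eventually_eq : ∀ᶠ z in 𝓝 0, L (polVec Λ (jet f z)) = sffVec f z

theorem IsSolutionGerm.congr {g : EuclideanSpace ℂ (Fin n) → EuclideanSpace ℂ (Fin k)}
    (hf : IsSolutionGerm Λ L f) (h : f =ᶠ[𝓝 0] g) : IsSolutionGerm Λ L g where
  map_zero := h.eq_of_nhds ▸ hf.map_zero
  fderiv_zero := h.fderiv_eq (𝕜 := ℂ) ▸ hf.fderiv_zero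
  eventually_eq := by
    filter_upwards [hf.eventually_eq, h.eventuallyEq_nhds] with z hz hfg
    rwa [← sffVec_congr hfg, ← jet_congr hfg]

variable {ρ R : ℝ}

theorem IsSolutionGerm.eqOn_ball (hf : IsSolutionGerm Λ L f)
    (hfρ : DifferentiableOn ℂ f (ball 0 ρ)) :
    EqOn (fun z => L (polVec Λ (jet f z))) (sffVec f) (ball 0 ρ) :=
  eqOn_ball_of_eventuallyEq (differentiableOn_sffVec isOpen_ball hfρ)
    (L.toContinuousLinearMap.differentiable.comp_differentiableOn
      ((differentiable_polVec Λ).comp_differentiableOn (differentiableOn_jet isOpen_ball hfρ)))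
    hf.eventually_eq

theorem IsSolutionGerm.norm_jet_le (hf : IsSolutionGerm Λ L f) (hΛ : 0 ≤ Λ)
    (hLnorm : ∀ v, ‖L v‖ ≤ ‖v‖) (hfρ : DifferentiableOn ℂ f (ball 0 ρ)) (hρR : ρ ≤ R)
    (hR : R < extRadius n Λ) {z : EuclideanSpace ℂ (Fin n)} (hz : z ∈ ball 0 ρ) :
    ‖jet f z‖ ≤ (1 - (extRadius n Λ)⁻¹ * R) ^ (-(2 / (3 * (n : ℝ) + 2))) := by
  have hΛpos := extRadius_pos n hΛ
  have hzR : ‖z‖ < R := (mem_ball_zero_iff.1 hz).trans_le hρR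
  calc ‖jet f z‖ ≤ jetNormSq f z := by
        rw [jetNormSq_eq_one_add_norm_sq_jet]
        nlinarith [sq_nonneg (‖jet f z‖ - 1)]
    _ ≤ (1 - (extRadius n Λ)⁻¹ * ‖z‖) ^ (-(2 / (3 * (n : ℝ) + 2))) :=
        jetNormSq_le_of_sffNormSq_le hΛ hfρ hf.map_zero hf.fderiv_zero
          (fun x hx => sffNormSq_le_of_norm_sffVec_le hΛ (hf.eqOn_ball hfρ hx ▸ hLnorm _)) hz
          (hzR.trans hR)
    _ ≤ (1 - (extRadius n Λ)⁻¹ * R) ^ (-(2 / (3 * (n : ℝ) + 2))) := by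
        refine Real.rpow_le_rpow_of_nonpos ?_ (by gcongr) (neg_nonpos.2 (by positivity))
        rw [sub_pos, inv_mul_lt_one₀ hΛpos]
        exact hR

/-- The value component of a jet. -/
def jetValue (w : JetSpace n k) : EuclideanSpace ℂ (Fin k) :=
  WithLp.toLp 2 fun a => w (Sum.inr (Sum.inl a))

theorem differentiable_jetValue : Differentiable ℂ (jetValue (n := n) (k := k)) :=
  differentiable_euclidean.2 fun _ => by
    simp only [jetValue]
    fun_prop

theorem norm_jetValue_le (w : JetSpace n k) : ‖jetValue w‖ ≤ ‖w‖ := by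
  refine pow_le_pow_iff_left₀ (norm_nonneg _) (norm_nonneg _) two_ne_zero |>.1 ?_
  simp only [EuclideanSpace.norm_sq_eq, jetValue, Fintype.sum_sum_type]
  exact le_add_of_nonneg_of_le (by positivity) (le_add_of_nonneg_right (by positivity))

theorem exists_forall_differentiableOn_taylorSum_add (hΛ : 0 ≤ Λ) (hLnorm : ∀ v, ‖L v‖ ≤ ‖v‖)
    (hR : R < extRadius n Λ) :
    ∃ δ > 0, ∀ (f : EuclideanSpace ℂ (Fin n) → EuclideanSpace ℂ (Fin k)) (ρ : ℝ), 0 < ρ → ρ ≤ R →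
      IsSolutionGerm Λ L f → DifferentiableOn ℂ f (ball 0 ρ) →
        DifferentiableOn ℂ (taylorSum f) (ball 0 (ρ + δ)) := by
  set M : ℝ := (1 - (extRadius n Λ)⁻¹ * R) ^ (-(2 / (3 * (n : ℝ) + 2)))
  obtain ⟨C, hC0, hC⟩ := exists_norm_jetField_le Λ L (M + 1)
  have hδ : 0 < 2 * Real.exp 1 * C + 1 := by positivity
  refine ⟨(2 * Real.exp 1 * C + 1)⁻¹, inv_pos.2 hδ, fun f ρ hρ hρR hf hfρ => ?_⟩
  refine differentiableOn_taylorSum_add (B := M + 1) hρ (inv_pos.2 hδ) hfρ fun v hv t ht j => ?_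
  have hmem : ∀ s ∈ ball (0 : ℂ) ρ, s • v ∈ ball 0 ρ := mapsTo_smul_ball hv
  have hjet : ∀ s ∈ ball (0 : ℂ) ρ, ‖jet f (s • v)‖ ≤ M := fun s hs =>
    hf.norm_jet_le hΛ hLnorm hfρ hρR hR (hmem s hs)
  have hM : 0 ≤ M := (norm_nonneg _).trans (hjet t ht)
  have hderiv : ‖iteratedDeriv j (fun t : ℂ => f (t • v)) t‖ ≤
      (M + 1) * j.factorial * (2 * Real.exp 1 * C) ^ j :=
    norm_iteratedDeriv_le_of_ode (differentiable_jetField v) differentiable_jetValue (hC v hv)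
      (fun w hw => (norm_jetValue_le w).trans hw)
      (fun s hs => hasDerivAt_jet_smul isOpen_ball hfρ (hmem s hs) (hf.eqOn_ball hfρ (hmem s hs)))
      hjet j ht
  rw [inv_pow, ← div_eq_mul_inv, div_le_iff₀ (by positivity)]
  refine hderiv.trans ?_
  gcongr
  exact le_add_of_nonneg_right zero_le_one

theorem IsSolutionGerm.differentiableOn_taylorSum (hf : IsSolutionGerm Λ L f) (hΛ : 0 ≤ Λ)
    (hLnorm : ∀ v, ‖L v‖ ≤ ‖v‖) (hρ : 0 < ρ) (hfρ : DifferentiableOn ℂ f (ball 0 ρ)) :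
    DifferentiableOn ℂ (taylorSum f) (ball 0 (extRadius n Λ)) := by
  intro z hz
  obtain ⟨R, hzR, hR⟩ := exists_between (mem_ball_zero_iff.1 hz)
  obtain ⟨δ, hδ, hstep⟩ := exists_forall_differentiableOn_taylorSum_add hΛ hLnorm hR
  have hgerm : taylorSum f =ᶠ[𝓝 0] f := taylorSum_eventuallyEq hρ hfρ
  have hgrow : ∀ j : ℕ, DifferentiableOn ℂ (taylorSum f) (ball 0 (min (ρ + j * δ) R)) := by
    intro j
    induction j with
    | zero =>
      exact (hfρ.congr (taylorSum_eqOn hfρ EventuallyEq.rfl)).mono (ball_subset_ball (by simp))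
    | succ j ih =>
      have hR0 : 0 < R := (norm_nonneg z).trans_lt hzR
      have hnext := hstep _ _ (by positivity) (min_le_right _ _) (hf.congr hgerm.symm) ih
      rw [taylorSum_congr hgerm] at hnext
      refine hnext.mono (ball_subset_ball ?_)
      rw [← min_add_add_right]
      push_cast
      exact min_le_min (by linarith) (by linarith)
  obtain ⟨j, hj⟩ := exists_nat_gt (R / δ)
  have hjR : R ≤ ρ + j * δ := by linarith [(div_lt_iff₀ hδ).1 hj]
  have hball := hgrow j
  rw [min_eq_right hjR] at hball
  exact (hball.differentiableAt
    (isOpen_ball.mem_nhds (mem_ball_zero_iff.2 hzR))).differentiableWithinAt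

end Continuation

end KahlerGraph

end

theorem lemma4p2 (n k : ℕ) (hn : 1 ≤ n) (hk : 1 ≤ k) (r Λ : ℝ) (hr : 0 < r) (hΛ : 0 ≤ Λ)
    (f : EuclideanSpace ℂ (Fin n) → EuclideanSpace ℂ (Fin k))
    (hf : DifferentiableOn ℂ f (Metric.ball 0 r))
    (hf0 : f 0 = 0) (hDf0 : fderiv ℂ f 0 = 0)
    (A : Matrix (Fin (n + k + 1)) (Fin (n + k + 1)) ℂ) (hA : A.IsHermitian)
    (hAΛ : ((Λ : ℂ) • (1 : Matrix (Fin (n + k + 1)) (Fin (n + k + 1)) ℂ) - A).PosSemidef)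
    (heq : ∀ z ∈ Metric.ball (0 : EuclideanSpace ℂ (Fin n)) r,
      (n : ℂ) * (n + 1)
          - 1 / 4 * KahlerGraph.scalarCurvature (KahlerGraph.graphMetric f) z
        = dotProduct (star (KahlerGraph.graphVec f z))
            (Matrix.mulVec A (KahlerGraph.graphVec f z))
          / ((1 + ‖z‖ ^ 2 + ‖f z‖ ^ 2 : ℝ) : ℂ)) :
    (∀ z ∈ Metric.ball (0 : EuclideanSpace ℂ (Fin n)) r, ‖z‖ < KahlerGraph.extRadius n Λ →
      1 + ‖z‖ ^ 2 + ‖f z‖ ^ 2 + KahlerGraph.gradNormSq f z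
        ≤ (1 - (KahlerGraph.extRadius n Λ)⁻¹ * ‖z‖) ^ (-(2 / (3 * (n : ℝ) + 2))))
    ∧ (r < KahlerGraph.extRadius n Λ →
      ∃ F : EuclideanSpace ℂ (Fin n) → EuclideanSpace ℂ (Fin k),
        DifferentiableOn ℂ F (Metric.ball 0 (KahlerGraph.extRadius n Λ)) ∧
        Set.EqOn F f (Metric.ball 0 r)) := by
  obtain ⟨L, hL, hLnorm⟩ :=
    KahlerGraph.exists_linear_sffVec hΛ Metric.isOpen_ball (convex_ball 0 r) hf hAΛ heq
  refine ⟨fun z hz hzΛ => ?_, fun _ => ⟨KahlerGraph.taylorSum f, ?_, ?_⟩⟩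
  · exact KahlerGraph.jetNormSq_le_of_sffNormSq_le hΛ hf hf0 hDf0
      (fun x hx => KahlerGraph.sffNormSq_le_of_norm_sffVec_le hΛ (hL x hx ▸ hLnorm _)) hz hzΛ
  · have hgerm : KahlerGraph.IsSolutionGerm Λ L f :=
      ⟨hf0, hDf0, Filter.eventually_of_mem (Metric.ball_mem_nhds 0 hr) hL⟩
    exact hgerm.differentiableOn_taylorSum hΛ hLnorm hr hf
  · exact KahlerGraph.taylorSum_eqOn hf Filter.EventuallyEq.rfl
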